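/- Let $n\ge 0$, let $\mathcal H=(\mathbb C^2)^{\otimes n}$ with computational basis $|x\rangle$, $x\in\{0,1\}^n$, and let $b_1,\dots,b_n$ be the fermionic annihilation operators, $b_j|x\rangle=(-1)^{x_1+\dots+x_{j-1}}|x\text{ with }x_j\text{ replaced by }0\rangle$ if $x_j=1$ and $b_j|x\rangle=0$ if $x_j=0$. Let $\gamma_{2j-1}=b_j+b_j^\dagger$ and $\gamma_{2j}=-i(b_j-b_j^\dagger)$ be the Majorana operators, let $\gamma_S$ ($S\subseteq[2n]$) be the product of the $\gamma_l$, $l\in S$, in increasing order ($\gamma_\emptyset=\mathbb I$), and let $$\mathcal P_{2k}(A)=\sum_{S\subseteq[2n],\,|S|=2k}\frac{\operatorname{tr}(\gamma_S^\dagger A)}{\operatorname{tr}(\gamma_S\gamma_S^\dagger)}\,\gamma_S$$ be the projector onto $\Gamma_{2k}=\operatorname{span}\{\gamma_S:|S|=2k\}$. For $Q\in\mathrm{Orth}(2n)$ let $U_Q$ be the unitary, unique up to a phase, with $U_Q^\dagger\gamma_uU_Q=\sum_vQ_{uv}\gamma_v$ for all $u$, let $\mathcal U_Q(A)=U_QAU_Q^\dagger$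 and $\mathcal U_Q^\dagger(A)=U_Q^\dagger AU_Q$, let $\mathcal X(A)=\sum_x\langle x|A|x\rangle\,|x\rangle\langle x|$, and let $\mu$ be the normalised Haar measure on $\mathrm{Orth}(2n)$. For a noise channel $\Lambda$ on $\mathcal L(\mathcal H)$ (any linear map is allowed, in particular any completely positive trace-preserving map) let $$\widetilde{\mathcal M}_\Lambda=\int \mathcal U_Q^\dagger\circ\mathcal X\circ\Lambda\circ\mathcal U_Q\;d\mu(Q)$$ be the noisy shadow channel, and for $0\le k\le n$ let $$\mathcal B_k(\Lambda)=\frac{(-i)^k}{2^n\binom nk}\sum_{x\in\{0,1\}^n}\ \sum_{S\subseteq[n],\,|S|=k}(-1)^{\sum_{j\in S}x_j}\operatorname{tr}\bigl(|x\rangle\langle x|\,\Lambda(\gamma_{D(S)})\bigr),\qquad D(S)=\bigcup_{j\in S}\{2j-1,2j\},$$ be the average fidelity of $\Lambda$ in the $\Gamma_{2k}$ subspace. Then there are unique coefficients $f_0,f_2,\dots,f_{2n}\in\mathbb C$ with $\widetilde{\mathcal M}_\Lambda=\sum_{k=0}^nf_{2k}\mathcal P_{2k}$ on $\mathcal L(\mathcal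 H)$, and they are $$f_{2k}=\binom{2n}{2k}^{-1}\binom nk\,\mathcal B_k(\Lambda),\qquad 0\le k\le n.$$ Moreover, if $\Lambda$ is the identity, then $\mathcal B_k(\Lambda)=1$ for all $0\le k\le n$, and $\widetilde{\mathcal M}_\Lambda$ is the noiseless matchgate shadow channel $$\mathcal M(A)=\int\sum_x\langle x|U_QAU_Q^\dagger|x\rangle\,U_Q^\dagger|x\rangle\langle x|U_Q\;d\mu(Q)=\sum_{k=0}^n\binom nk\binom{2n}{2k}^{-1}\mathcal P_{2k}(A).$$ -/

import Mathlib

open MeasureTheory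
open scoped Matrix

noncomputable section

namespace FermionicShadow

/-- Computational basis labels `x ∈ {0,1}ⁿ` (equivalently, occupation numbers of `n` modes). -/
abbrev Bits (n : ℕ) := Fin n → Fin 2

/-- Linear operators on the `2ⁿ`-dimensional Hilbert space, written in the computational basis. -/
abbrev Op (n : ℕ) := Matrix (Bits n) (Bits n) ℂ

/-- The rank-one projector `|x⟩⟨x|`. -/
def proj {n : ℕ} (x : Bits n) : Op n := Matrix.single x x 1

/-! ### Majorana operators -/

/-- The Jordan–Wigner sign `(-1)^{x₁ + ⋯ + x_{j-1}}`. -/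
def jwSign {n : ℕ} (j : Fin n) (x : Bits n) : ℂ :=
  ∏ l with l < j, (-1 : ℂ) ^ (x l : ℕ)

/-- The annihilation operator of the `j`-th mode:
`b_j |x⟩ = (-1)^{x₁ + ⋯ + x_{j-1}} |x with x_j replaced by 0⟩` if `x_j = 1`, and `b_j |x⟩ = 0`
if `x_j = 0`. -/
def annihilation {n : ℕ} (j : Fin n) : Op n :=
  Matrix.of fun y x => if x j = 1 ∧ y = Function.update x j 0 then jwSign j x else 0

/-- The mode to which a Majorana index belongs: the (zero-based) indices `2j` and `2j+1` belong to
mode `j`. -/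
def modeOf {n : ℕ} (u : Fin (2 * n)) : Fin n := ⟨(u : ℕ) / 2, by omega⟩

/-- The Majorana operators `b_j + b_j†` (zero-based index `2j`) and `-i (b_j - b_j†)`
(zero-based index `2j+1`). -/
def majorana {n : ℕ} (u : Fin (2 * n)) : Op n :=
  if (u : ℕ) % 2 = 0 then annihilation (modeOf u) + (annihilation (modeOf u))ᴴ
  else -Complex.I • (annihilation (modeOf u) - (annihilation (modeOf u))ᴴ)

/-- The Majorana product `γ_S`, factors in increasing order of the index; `γ_∅ = 1`. -/
def majoranaProd {n : ℕ} (S : Finset (Fin (2 * n))) : Op n :=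
  (S.sort.map majorana).prod

/-- `D(S)`: the Majorana indices of all modes in `S`. -/
def pairs {n : ℕ} (S : Finset (Fin n)) : Finset (Fin (2 * n)) :=
  {u | modeOf u ∈ S}

/-- The projector `𝒫_k = ∑_{|S| = k} |γ_S⟫⟪γ_S|` onto `Γ_k = span {γ_S : |S| = k}`, where
`|O⟫ = O / √tr(O O†)` and `⟪O|A⟫ = tr(O† A) / √tr(O O†)`. -/
def majoranaProjector (n k : ℕ) (A : Op n) : Op n :=
  ∑ S ∈ (Finset.univ : Finset (Fin (2 * n))).powersetCard k,
    (((majoranaProd S)ᴴ * A).trace / (majoranaProd S * (majoranaProd S)ᴴ).trace) • majoranaProd S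

/-! ### Gaussian unitaries -/

/-- `U` is a fermionic Gaussian unitary for the orthogonal matrix `Q`:
`U† γ_u U = ∑_v Q_{uv} γ_v` for all `u`. This fixes `U` up to a global phase. -/
def IsGaussianUnitary {n : ℕ} (Q : Matrix.orthogonalGroup (Fin (2 * n)) ℝ) (U : Op n) : Prop :=
  U ∈ Matrix.unitaryGroup (Bits n) ℂ ∧
    ∀ u, Uᴴ * majorana u * U = ∑ v, ((Q : Matrix _ _ ℝ) u v : ℂ) • majorana v

/-! The lemmas up to `exists_isGaussianUnitary` show that every orthogonal matrix is implemented by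
a Gaussian unitary. -/

def flipAt {n : ℕ} (j : Fin n) (x : Bits n) : Bits n := Function.update x j (1 - x j)

theorem flipAt_self {n : ℕ} (j : Fin n) (x : Bits n) : flipAt j x j = 1 - x j := by
  simp [flipAt]

theorem flipAt_ne {n : ℕ} {j l : Fin n} (h : l ≠ j) (x : Bits n) : flipAt j x l = x l := by
  simp [flipAt, h]

theorem flipAt_flipAt {n : ℕ} (j : Fin n) (x : Bits n) : flipAt j (flipAt j x) = x := by
  ext l
  by_cases h : l = j
  · subst h; simp [flipAt_self]
  · simp [flipAt_ne h]

theorem flipAt_comm {n : ℕ} (i j : Fin n) (x : Bits n) :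
    flipAt i (flipAt j x) = flipAt j (flipAt i x) := by
  ext l
  by_cases hi : l = i <;> by_cases hj : l = j
  · subst hi; subst hj; rfl
  · subst hi; simp [flipAt_self, flipAt_ne hj]
  · subst hj; simp [flipAt_self, flipAt_ne hi]
  · simp [flipAt_ne hi, flipAt_ne hj]

theorem eq_flipAt_comm {n : ℕ} (j : Fin n) (x y : Bits n) : y = flipAt j x ↔ x = flipAt j y := by
  constructor <;> rintro rfl <;> rw [flipAt_flipAt]

theorem sign_flip (a : Fin 2) : (-1 : ℂ) ^ ((1 - a : Fin 2) : ℕ) = -(-1) ^ (a : ℕ) := by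
  fin_cases a <;> simp

theorem jwSign_flipAt_of_le {n : ℕ} {i j : Fin n} (h : j ≤ i) (x : Bits n) :
    jwSign j (flipAt i x) = jwSign j x := by
  refine Finset.prod_congr rfl fun l hl => ?_
  rw [flipAt_ne]
  rintro rfl
  exact absurd (Finset.mem_filter.1 hl).2 (not_lt.2 h)

theorem jwSign_flipAt_of_lt {n : ℕ} {i j : Fin n} (h : i < j) (x : Bits n) :
    jwSign j (flipAt i x) = -jwSign j x := by
  have hi : i ∈ Finset.univ.filter (fun l => l < j) := by simp [h]
  unfold jwSign
  rw [← Finset.mul_prod_erase _ _ hi, ← Finset.mul_prod_erase _ _ hi, flipAt_self, sign_flip,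
    neg_mul]
  congr 2
  refine Finset.prod_congr rfl fun l hl => ?_
  rw [flipAt_ne (Finset.ne_of_mem_erase hl)]

theorem jwSign_mul_self {n : ℕ} (j : Fin n) (x : Bits n) : jwSign j x * jwSign j x = 1 := by
  unfold jwSign
  rw [← Finset.prod_mul_distrib]
  refine Finset.prod_eq_one fun l _ => ?_
  rw [← pow_add, ← two_mul, pow_mul]; simp

theorem star_jwSign {n : ℕ} (j : Fin n) (x : Bits n) : star (jwSign j x) = jwSign j x := by
  unfold jwSign
  rw [star_prod]
  refine Finset.prod_congr rfl fun l _ => ?_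
  simp

/-- The nonzero matrix elements of a Majorana operator. -/
def majCoeff {n : ℕ} (u : Fin (2 * n)) (x : Bits n) : ℂ :=
  if (u : ℕ) % 2 = 0 then jwSign (modeOf u) x
  else Complex.I * (-1) ^ (x (modeOf u) : ℕ) * jwSign (modeOf u) x

theorem annihilation_apply {n : ℕ} (j : Fin n) (y x : Bits n) :
    annihilation j y x = if y = flipAt j x ∧ x j = 1 then jwSign j x else 0 := by
  unfold annihilation flipAt
  simp only [Matrix.of_apply]
  by_cases h : x j = 1
  · simp [h]
  · simp [h]

theorem fin2_cases (a : Fin 2) : a = 0 ∨ a = 1 := by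
  fin_cases a <;> simp

theorem majorana_apply {n : ℕ} (u : Fin (2 * n)) (y x : Bits n) :
    majorana u y x = if y = flipAt (modeOf u) x then majCoeff u x else 0 := by
  have hH : (annihilation (modeOf u))ᴴ y x =
      if y = flipAt (modeOf u) x ∧ x (modeOf u) = 0 then jwSign (modeOf u) x else 0 := by
    rw [Matrix.conjTranspose_apply, annihilation_apply]
    by_cases h : y = flipAt (modeOf u) x
    · subst h
      rcases fin2_cases (x (modeOf u)) with h0 | h0 <;>
        simp [flipAt_flipAt, flipAt_self, h0, jwSign_flipAt_of_le le_rfl]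
      exact star_jwSign _ _
    · have h' : ¬ x = flipAt (modeOf u) y := fun h' => h ((eq_flipAt_comm _ _ _).2 h')
      simp [h, h']
  unfold majorana majCoeff
  split_ifs with hu h h
  · rw [Matrix.add_apply, hH, annihilation_apply]
    rcases fin2_cases (x (modeOf u)) with h0 | h0 <;> simp [h, h0]
  · rw [Matrix.add_apply, hH, annihilation_apply]
    simp [h]
  · rw [Matrix.smul_apply, Matrix.sub_apply, hH, annihilation_apply]
    rcases fin2_cases (x (modeOf u)) with h0 | h0 <;> simp [h, h0]
  · rw [Matrix.smul_apply, Matrix.sub_apply, hH, annihilation_apply]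
    simp [h]

theorem majorana_mul_apply {n : ℕ} (u v : Fin (2 * n)) (y x : Bits n) :
    (majorana u * majorana v) y x =
      if y = flipAt (modeOf u) (flipAt (modeOf v) x) then
        majCoeff u (flipAt (modeOf v) x) * majCoeff v x else 0 := by
  rw [Matrix.mul_apply, Finset.sum_eq_single (flipAt (modeOf v) x)]
  · simp [majorana_apply]
  · intro z _ hz
    simp [majorana_apply u, majorana_apply v, hz]
  · simp

theorem majCoeff_anticomm_of_lt {n : ℕ} {u v : Fin (2 * n)} (h : modeOf u < modeOf v)
    (x : Bits n) :
    majCoeff u (flipAt (modeOf v) x) * majCoeff v x +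
      majCoeff v (flipAt (modeOf u) x) * majCoeff u x = 0 := by
  unfold majCoeff
  rw [jwSign_flipAt_of_le h.le, jwSign_flipAt_of_lt h, flipAt_ne h.ne, flipAt_ne h.ne']
  split_ifs <;> ring

theorem majorana_anticomm {n : ℕ} (u v : Fin (2 * n)) :
    majorana u * majorana v + majorana v * majorana u = if u = v then 2 else 0 := by
  ext y x
  rw [Matrix.add_apply, majorana_mul_apply, majorana_mul_apply,
    flipAt_comm (modeOf v) (modeOf u)]
  rcases lt_trichotomy (modeOf u) (modeOf v) with h | h | h
  · have huv : u ≠ v := by rintro rfl; exact lt_irrefl _ h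
    rw [if_neg huv]
    split_ifs
    · exact majCoeff_anticomm_of_lt h x
    · simp
  · rw [h, flipAt_flipAt]
    have hs := jwSign_mul_self (modeOf v) x
    have hp : ((-1 : ℂ) ^ (x (modeOf v) : ℕ)) * (-1) ^ (x (modeOf v) : ℕ) = 1 := by
      rw [← pow_add, ← two_mul, pow_mul]; simp
    have hm : (u : ℕ) / 2 = (v : ℕ) / 2 := congrArg Fin.val h
    have hII := Complex.I_mul_I
    have h2 : (2 : Op n) x x = 2 := by
      rw [← Nat.cast_ofNat (R := Op n), Matrix.natCast_apply]; simp
    have h2' : y ≠ x → (2 : Op n) y x = 0 := by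
      intro hyx
      rw [← Nat.cast_ofNat (R := Op n), Matrix.natCast_apply]; simp [hyx]
    by_cases hyx : y = x
    · unfold majCoeff
      rw [h, flipAt_self, sign_flip, jwSign_flipAt_of_le le_rfl]
      by_cases hu : (u : ℕ) % 2 = 0 <;> by_cases hv : (v : ℕ) % 2 = 0
      · have huv : u = v := by ext; omega
        simp only [hv, if_true, huv, h2, hyx]
        linear_combination 2 * hs
      · have huv : u ≠ v := by rintro rfl; exact hv hu
        simp only [hu, hv, if_true, if_false, huv, hyx, Matrix.zero_apply]
        ring
      · have huv : u ≠ v := by rintro rfl; exact hu hv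
        simp only [hu, hv, if_true, if_false, huv, hyx, Matrix.zero_apply]
        ring
      · have huv : u = v := by ext; omega
        simp only [hv, if_true, if_false, huv, h2, hyx]
        linear_combination (-2 * Complex.I * Complex.I * ((-1 : ℂ) ^ (x (modeOf v) : ℕ)) *
          (-1) ^ (x (modeOf v) : ℕ)) * hs + (-2 * Complex.I * Complex.I) * hp - 2 * hII
    · by_cases huv : u = v <;> simp [huv, hyx, h2' hyx]
  · have huv : u ≠ v := by rintro rfl; exact lt_irrefl _ h
    rw [if_neg huv]
    split_ifs
    · rw [add_comm]; exact majCoeff_anticomm_of_lt h x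
    · simp

theorem majorana_conjTranspose {n : ℕ} (u : Fin (2 * n)) : (majorana u)ᴴ = majorana u := by
  unfold majorana
  split_ifs
  · simp [add_comm]
  · simp [Matrix.conjTranspose_smul, smul_sub]
    abel

/-- The fermion parity operator. -/
def parity (n : ℕ) : Op n := Matrix.diagonal fun x => ∏ l, (-1 : ℂ) ^ (x l : ℕ)

theorem parity_mul_self (n : ℕ) : parity n * parity n = 1 := by
  unfold parity
  rw [Matrix.diagonal_mul_diagonal, ← Matrix.diagonal_one]
  congr 1
  ext x
  rw [← Finset.prod_mul_distrib]
  refine Finset.prod_eq_one fun l _ => ?_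
  rw [← pow_add, ← two_mul, pow_mul]; simp

theorem parity_conjTranspose (n : ℕ) : (parity n)ᴴ = parity n := by
  unfold parity
  rw [Matrix.diagonal_conjTranspose]
  congr 1
  ext x
  simp [Pi.star_apply]

theorem parity_mul_majorana {n : ℕ} (u : Fin (2 * n)) :
    parity n * majorana u = -(majorana u * parity n) := by
  ext y x
  unfold parity
  rw [Matrix.neg_apply, Matrix.diagonal_mul, Matrix.mul_diagonal, majorana_apply]
  split_ifs with h
  · subst h
    rw [← Finset.mul_prod_erase _ _ (Finset.mem_univ (modeOf u)),
      ← Finset.mul_prod_erase _ _ (Finset.mem_univ (modeOf u)), flipAt_self, sign_flip,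
      Finset.prod_congr (g := fun l => (-1 : ℂ) ^ (x l : ℕ)) rfl fun l hl => by
        rw [flipAt_ne (Finset.ne_of_mem_erase hl)]]
    ring
  · simp

/-- The Majorana operator `∑_u v_u γ_u` of a real vector `v`. -/
def majVec {n : ℕ} (v : EuclideanSpace ℝ (Fin (2 * n))) : Op n := ∑ u, (v u : ℂ) • majorana u

theorem majVec_add {n : ℕ} (v w : EuclideanSpace ℝ (Fin (2 * n))) :
    majVec (v + w) = majVec v + majVec w := by
  simp [majVec, add_smul, Finset.sum_add_distrib]

theorem majVec_smul {n : ℕ} (c : ℝ) (v : EuclideanSpace ℝ (Fin (2 * n))) :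
    majVec (c • v) = (c : ℂ) • majVec v := by
  simp [majVec, mul_smul, Finset.smul_sum]

theorem majVec_anticomm {n : ℕ} (v w : EuclideanSpace ℝ (Fin (2 * n))) :
    majVec v * majVec w + majVec w * majVec v = ((2 * inner ℝ v w : ℝ) : ℂ) • 1 := by
  unfold majVec
  rw [Finset.sum_mul_sum, Finset.sum_mul_sum, Finset.sum_comm (s := Finset.univ)
    (f := fun i j => ((w i : ℂ) • majorana i) * ((v j : ℂ) • majorana j)),
    ← Finset.sum_add_distrib]
  have key : ∀ i j : Fin (2 * n), ((v i : ℂ) • majorana i) * ((w j : ℂ) • majorana j) +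
      ((w j : ℂ) • majorana j) * ((v i : ℂ) • majorana i) =
      if i = j then ((2 * (v i * w j) : ℝ) : ℂ) • (1 : Op n) else 0 := by
    intro i j
    have h := majorana_anticomm i j
    rw [smul_mul_smul_comm, smul_mul_smul_comm, mul_comm (w j : ℂ), ← smul_add, h]
    split_ifs
    · have : (2 : Op n) = (2 : ℂ) • 1 := by
        rw [two_smul, one_add_one_eq_two]
      rw [this, smul_smul]
      push_cast
      ring_nf
    · simp
  simp_rw [← Finset.sum_add_distrib, key]
  simp only [Finset.sum_ite_eq, Finset.mem_univ, if_true]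
  rw [← Finset.sum_smul]
  congr 1
  simp [PiLp.inner_apply, Finset.mul_sum, mul_comm]

theorem majVec_conjTranspose {n : ℕ} (v : EuclideanSpace ℝ (Fin (2 * n))) :
    (majVec v)ᴴ = majVec v := by
  simp [majVec, Matrix.conjTranspose_sum, Matrix.conjTranspose_smul, majorana_conjTranspose]

theorem parity_mul_majVec {n : ℕ} (v : EuclideanSpace ℝ (Fin (2 * n))) :
    parity n * majVec v = -(majVec v * parity n) := by
  simp [majVec, Finset.mul_sum, Finset.sum_mul, parity_mul_majorana]

theorem exists_unitary_reflection {n : ℕ} (a : EuclideanSpace ℝ (Fin (2 * n))) :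
    ∃ U ∈ Matrix.unitaryGroup (Bits n) ℂ, ∀ v : EuclideanSpace ℝ (Fin (2 * n)),
      Uᴴ * majVec v * U = majVec ((ℝ ∙ a)ᗮ.reflection v) := by
  by_cases ha : a = 0
  · subst ha
    refine ⟨1, one_mem _, fun v => ?_⟩
    rw [Submodule.reflection_orthogonal_apply, Submodule.reflection_singleton_apply]
    simp
  · obtain ⟨e, h1, hr⟩ : ∃ e : EuclideanSpace ℝ (Fin (2 * n)), inner ℝ e e = (1 : ℝ) ∧
        ∀ v, (ℝ ∙ a)ᗮ.reflection v = v + (-(2 * inner ℝ v e)) • e := by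
      have hna : ‖a‖ ≠ 0 := norm_ne_zero_iff.2 ha
      refine ⟨‖a‖⁻¹ • a, ?_, fun v => ?_⟩
      · rw [real_inner_self_eq_norm_sq, norm_smul, norm_inv, norm_norm,
          inv_mul_cancel₀ hna, one_pow]
      · rw [Submodule.reflection_orthogonal_apply, Submodule.reflection_singleton_apply,
          inner_smul_right, real_inner_comm v a, smul_smul, ← Nat.cast_smul_eq_nsmul ℝ 2,
          smul_smul, neg_sub, sub_eq_add_neg, ← neg_smul]
        congr 2
        simp only [RCLike.ofReal_real_eq_id, id]
        field_simp
        push_cast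
        ring
    have hee : majVec e * majVec e = 1 := by
      have h := majVec_anticomm e e
      rw [h1, ← two_smul ℂ (majVec e * majVec e)] at h
      have h' := congrArg (fun B => (2 : ℂ)⁻¹ • B) h
      simpa [smul_smul] using h'
    have hpp := parity_mul_self n
    have hH : (majVec e * parity n)ᴴ = parity n * majVec e := by
      rw [Matrix.conjTranspose_mul, majVec_conjTranspose, parity_conjTranspose]
    refine ⟨majVec e * parity n, ?_, fun v => ?_⟩
    · rw [Matrix.mem_unitaryGroup_iff, Matrix.star_eq_conjTranspose, hH]
      calc majVec e * parity n * (parity n * majVec e)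
          = majVec e * (parity n * parity n) * majVec e := by simp only [mul_assoc]
        _ = 1 := by rw [hpp, mul_one, hee]
    · have hv := majVec_anticomm v e
      have hv' : majVec v * majVec e =
          ((2 * inner ℝ v e : ℝ) : ℂ) • 1 - majVec e * majVec v := by
        rw [← hv]; abel
      have h1 : majVec e * majVec v * majVec e =
          ((2 * inner ℝ v e : ℝ) : ℂ) • majVec e - majVec v := by
        rw [mul_assoc, hv', mul_sub, ← mul_assoc, hee, one_mul, mul_smul_comm, mul_one]
      have h2 : ∀ w : EuclideanSpace ℝ (Fin (2 * n)),
          parity n * majVec w * parity n = -majVec w := by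
        intro w
        rw [parity_mul_majVec, neg_mul, mul_assoc, hpp, mul_one]
      rw [hH, hr, majVec_add, majVec_smul]
      calc parity n * majVec e * majVec v * (majVec e * parity n)
          = parity n * (majVec e * majVec v * majVec e) * parity n := by simp only [mul_assoc]
        _ = _ := by
          rw [h1, mul_sub, sub_mul, mul_smul_comm, smul_mul_assoc, h2, h2]
          push_cast
          rw [neg_smul, smul_neg]
          abel

theorem exists_unitary_isometry {n : ℕ}
    (φ : EuclideanSpace ℝ (Fin (2 * n)) ≃ₗᵢ[ℝ] EuclideanSpace ℝ (Fin (2 * n))) :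
    ∃ U ∈ Matrix.unitaryGroup (Bits n) ℂ, ∀ v, Uᴴ * majVec v * U = majVec (φ v) := by
  obtain ⟨l, -, rfl⟩ := φ.reflections_generate_dim
  induction l with
  | nil => exact ⟨1, one_mem _, fun v => by simp⟩
  | cons a l ih =>
    obtain ⟨U, hU, h⟩ := ih
    obtain ⟨V, hV, h'⟩ := exists_unitary_reflection a
    refine ⟨U * V, mul_mem hU hV, fun v => ?_⟩
    rw [List.map_cons, List.prod_cons, LinearIsometryEquiv.coe_mul, Function.comp_apply, ← h', ← h,
      Matrix.conjTranspose_mul]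
    simp only [mul_assoc]

theorem exists_isGaussianUnitary {n : ℕ} (Q : Matrix.orthogonalGroup (Fin (2 * n)) ℝ) :
    ∃ U : Op n, IsGaussianUnitary Q U := by
  have hQ : (Q : Matrix (Fin (2 * n)) (Fin (2 * n)) ℝ) *
      (Q : Matrix (Fin (2 * n)) (Fin (2 * n)) ℝ)ᵀ = 1 :=
    (Matrix.mem_orthogonalGroup_iff (Fin (2 * n)) ℝ).1 Q.2
  let f : EuclideanSpace ℝ (Fin (2 * n)) →ₗ[ℝ] EuclideanSpace ℝ (Fin (2 * n)) :=
    Matrix.toEuclideanLin (Q : Matrix (Fin (2 * n)) (Fin (2 * n)) ℝ)ᵀ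
  have hf : ∀ x y, inner ℝ (f x) (f y) = inner ℝ x y := by
    intro x y
    have h : ∀ x y : EuclideanSpace ℝ (Fin (2 * n)),
        inner ℝ x y = y.ofLp ⬝ᵥ x.ofLp := by
      intro x y
      simp [PiLp.inner_apply, dotProduct]
    rw [h, h]
    change (Q : Matrix (Fin (2 * n)) (Fin (2 * n)) ℝ)ᵀ *ᵥ y.ofLp ⬝ᵥ (Q : Matrix (Fin (2 * n)) (Fin (2 * n)) ℝ)ᵀ *ᵥ x.ofLp = _
    rw [Matrix.dotProduct_mulVec, Matrix.vecMul_transpose, Matrix.mulVec_mulVec, hQ,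
      Matrix.one_mulVec]
  obtain ⟨U, hU, h⟩ := exists_unitary_isometry ((f.isometryOfInner hf).toLinearIsometryEquiv rfl)
  refine ⟨U, hU, fun u => ?_⟩
  have h1 := h (EuclideanSpace.single u 1)
  have h2 : majVec (EuclideanSpace.single u (1 : ℝ)) = majorana u := by
    simp [majVec]
  rw [h2] at h1
  rw [h1]
  unfold majVec
  refine Finset.sum_congr rfl fun v _ => ?_
  congr 2
  change ((Q : Matrix (Fin (2 * n)) (Fin (2 * n)) ℝ)ᵀ *ᵥ (EuclideanSpace.single u (1 : ℝ)).ofLp) v = _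
  simp

/-- A Gaussian unitary (matchgate) `U_Q` for `Q`, with an arbitrarily chosen phase. Only the
channel `A ↦ U_Q A U_Q†` and its inverse are used below, and they do not depend on the phase. -/
def gaussianUnitary {n : ℕ} (Q : Matrix.orthogonalGroup (Fin (2 * n)) ℝ) : Op n :=
  (exists_isGaussianUnitary Q).choose

theorem gaussianUnitary_spec {n : ℕ} (Q : Matrix.orthogonalGroup (Fin (2 * n)) ℝ) :
    IsGaussianUnitary Q (gaussianUnitary Q) :=
  (exists_isGaussianUnitary Q).choose_spec

/-! ### Normalised Haar measure on the orthogonal group -/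

instance instMeasurableSpaceOrthogonalGroup (m : ℕ) :
    MeasurableSpace (Matrix.orthogonalGroup (Fin m) ℝ) := borel _

instance instBorelSpaceOrthogonalGroup (m : ℕ) :
    BorelSpace (Matrix.orthogonalGroup (Fin m) ℝ) := ⟨rfl⟩

instance instCompactSpaceOrthogonalGroup (m : ℕ) :
    CompactSpace (Matrix.orthogonalGroup (Fin m) ℝ) := by
  refine isCompact_iff_compactSpace.1 (IsCompact.of_isClosed_subset
    (isCompact_univ_pi fun _ : Fin m => isCompact_univ_pi fun _ : Fin m =>
      isCompact_closedBall (0 : ℝ) 1) isClosed_unitary ?_)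
  intro A hA i _ j _
  rw [mem_closedBall_zero_iff]
  exact entry_norm_bound_of_unitary hA i j

/-- The Haar measure `μ` on `Orth(m)` with `μ(Orth(m)) = 1`. -/
def orthHaar (m : ℕ) : Measure (Matrix.orthogonalGroup (Fin m) ℝ) :=
  Measure.haarMeasure ⊤

/-! ### Channels -/

/-- The unitary channel `A ↦ U A U†`. -/
def unitaryChannel {n : ℕ} (U : Op n) (A : Op n) : Op n := U * A * Uᴴ

/-- The channel `𝒳 = ∑_x |x⟫⟪x|` of the computational basis measurement:
`𝒳(A) = ∑_x ⟨x|A|x⟩ |x⟩⟨x|`. -/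
def measurementChannel {n : ℕ} (A : Op n) : Op n := ∑ x, (proj x * A).trace • proj x

/-- The noisy shadow channel `∫ dμ(Q) 𝒰_Q† ∘ 𝒳 ∘ Λ ∘ 𝒰_Q`, the integral of operators being taken
entrywise. -/
def noisyShadowChannel {n : ℕ} (Λ : Op n →ₗ[ℂ] Op n) (A : Op n) : Op n :=
  Matrix.of fun y z => ∫ Q, unitaryChannel (gaussianUnitary Q)ᴴ
    (measurementChannel (Λ (unitaryChannel (gaussianUnitary Q) A))) y z ∂(orthHaar (2 * n))

/-- The noiseless matchgate shadow channel
`A ↦ ∫ dμ(Q) ∑_x ⟨x|U_Q A U_Q†|x⟩ U_Q† |x⟩⟨x| U_Q`, the integral being taken entrywise. -/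
def shadowChannel {n : ℕ} (A : Op n) : Op n :=
  Matrix.of fun y z => ∫ Q,
    (∑ x : Bits n, (gaussianUnitary Q * A * (gaussianUnitary Q)ᴴ) x x •
      ((gaussianUnitary Q)ᴴ * proj x * gaussianUnitary Q)) y z ∂(orthHaar (2 * n))

/-- The average fidelity of `Λ` in the `Γ_{2k}` subspace,
`𝓑_k = (-i)^k / (2ⁿ C(n,k)) ∑_x ∑_{S ⊆ [n], |S| = k} (-1)^{x_S} tr(|x⟩⟨x| Λ(γ_{D(S)}))`
with `x_S = ∑_{j ∈ S} x_j`. -/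
def avgFidelity {n : ℕ} (Λ : Op n →ₗ[ℂ] Op n) (k : ℕ) : ℂ :=
  (-Complex.I) ^ k / (2 ^ n * (n.choose k : ℂ)) *
    ∑ x : Bits n, ∑ S ∈ (Finset.univ : Finset (Fin n)).powersetCard k,
      (-1 : ℂ) ^ (∑ j ∈ S, (x j : ℕ)) * (proj x * Λ (majoranaProd (pairs S))).trace

end FermionicShadow

end

noncomputable section

namespace FermionicShadow

variable {n : ℕ}

/-! ### Majorana products -/

/-! The integrand is `𝒰_Q† ∘ K ∘ 𝒰_Q` with `K = 𝒳 ∘ Λ`, so the noisy shadow channel is the twirl of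
`K` over the orthogonal group (`noisyShadowChannel_eq_twirl`). By invariance of Haar measure the
twirl commutes with every Gaussian conjugation (`twirl_conj`). In place of Schur's lemma, two finite
families of orthogonal matrices determine its shape. Coordinate reflections multiply the `γ_S` by
signs that separate all subsets `S`, so the twirl is diagonal in the Majorana basis
(`majoranaCoeff_twirl_of_ne`). Permutation matrices carry any `γ_S` to any `γ_T` with `|S| = |T|`,
up to a scalar, so the eigenvalue depends only on `|S|` (`majoranaCoeff_twirl_eq_of_card_eq`).

The eigenvalue is then read off from a trace. Each `Γ_k` is stable under Gaussian conjugation, being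
an eigenspace of `A ↦ ∑_u γ_u A γ_u`, which commutes with these conjugations. Hence `K` and its
twirl have the same trace over `Γ_k` (`sum_majoranaCoeff_twirl`), and the eigenvalue is this trace
divided by the dimension `C(2n,k)`.

For `K = 𝒳 ∘ Λ` only diagonal matrix elements enter the trace. The diagonal of `γ_S` vanishes unless
`S` is a union of full mode pairs `D(T)`, where it is `i^|T| (-1)^{x_T}`
(`majoranaProd_diag_eq_zero`, `majoranaProd_pairs`). So odd degrees drop out, and degree `2k` gives
`C(n,k) 𝓑_k`. -/

theorem majorana_mul_self (u : Fin (2 * n)) : majorana u * majorana u = 1 := by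
  have h := majorana_anticomm u u
  rw [if_pos rfl, ← two_mul] at h
  have h2 : (2 : Op n) = (2 : ℂ) • 1 := by rw [two_smul, one_add_one_eq_two]
  rw [h2, smul_mul_assoc, one_mul] at h
  exact smul_right_injective _ (two_ne_zero' ℂ) h

theorem majorana_mul_of_ne {u v : Fin (2 * n)} (h : u ≠ v) :
    majorana u * majorana v = -(majorana v * majorana u) := by
  have h' := majorana_anticomm u v
  rw [if_neg h] at h'
  exact eq_neg_of_add_eq_zero_left h'

theorem majoranaProd_empty : majoranaProd (∅ : Finset (Fin (2 * n))) = 1 := by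
  simp [majoranaProd]

theorem majoranaProd_insert {u : Fin (2 * n)} {S : Finset (Fin (2 * n))}
    (h : ∀ v ∈ S, u < v) : majoranaProd (insert u S) = majorana u * majoranaProd S := by
  unfold majoranaProd
  rw [Finset.sort_insert _ (fun v hv => (h v hv).le) (fun hu => lt_irrefl _ (h u hu)),
    List.map_cons, List.prod_cons]

theorem list_prod_mul_conjTranspose (l : List (Fin (2 * n))) :
    (l.map majorana).prod * ((l.map majorana).prod)ᴴ = 1 := by
  induction l with
  | nil => simp
  | cons u l ih =>
    rw [List.map_cons, List.prod_cons, Matrix.conjTranspose_mul, mul_assoc,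
      ← mul_assoc _ _ (majorana u)ᴴ, ih, one_mul, majorana_conjTranspose, majorana_mul_self]

theorem majoranaProd_mul_conjTranspose (S : Finset (Fin (2 * n))) :
    majoranaProd S * (majoranaProd S)ᴴ = 1 :=
  list_prod_mul_conjTranspose _

theorem conjTranspose_mul_majoranaProd (S : Finset (Fin (2 * n))) :
    (majoranaProd S)ᴴ * majoranaProd S = 1 :=
  mul_eq_one_comm.1 (majoranaProd_mul_conjTranspose S)

theorem trace_one_op : (1 : Op n).trace = 2 ^ n := by
  simp [Matrix.trace_one, Fintype.card_pi]

/-- A Majorana index moves through a product of Majorana operators up to a sign. -/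
theorem majorana_mul_majoranaProd_mul (u : Fin (2 * n)) (S : Finset (Fin (2 * n))) :
    majorana u * majoranaProd S * majorana u =
      ((-1) ^ S.card * if u ∈ S then -1 else 1 : ℂ) • majoranaProd S := by
  induction S using Finset.induction_on_min with
  | empty => simp [majoranaProd_empty, majorana_mul_self]
  | insert v S hv ih =>
    have hvS : v ∉ S := fun h => lt_irrefl _ (hv v h)
    have hc : majorana u * majorana v =
        (if u = v then 1 else -1 : ℂ) • (majorana v * majorana u) := by
      split_ifs with h
      · rw [h, one_smul]
      · rw [majorana_mul_of_ne h, neg_one_smul]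
    rw [majoranaProd_insert hv, ← mul_assoc, hc, smul_mul_assoc, smul_mul_assoc, mul_assoc,
      mul_assoc, ← mul_assoc (majorana u), ih, mul_smul_comm, smul_smul,
      Finset.card_insert_of_notMem hvS, pow_succ]
    congr 1
    by_cases h : u = v
    · subst h; simp [hvS]
    · simp [h]

/-- Transposing neighbours costs a sign, or nothing if they coincide. Only `ε ≠ 0` is needed later,
so the sign of the permutation is not tracked. -/
theorem list_prod_perm {l l' : List (Fin (2 * n))} (h : l.Perm l') :
    ∃ ε : ℂ, ε ≠ 0 ∧ (l.map majorana).prod = ε • (l'.map majorana).prod := by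
  induction h with
  | nil => exact ⟨1, one_ne_zero, by simp⟩
  | cons u _ ih =>
    obtain ⟨ε, hε, h⟩ := ih
    exact ⟨ε, hε, by simp [h]⟩
  | swap u v l =>
    by_cases h : u = v
    · exact ⟨1, one_ne_zero, by simp [h]⟩
    · refine ⟨-1, by simp, ?_⟩
      simp only [List.map_cons, List.prod_cons, ← mul_assoc, majorana_mul_of_ne h]
      simp
  | trans _ _ ih ih' =>
    obtain ⟨ε, hε, h⟩ := ih
    obtain ⟨ε', hε', h'⟩ := ih'
    exact ⟨ε * ε', mul_ne_zero hε hε', by rw [h, h', smul_smul]⟩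

/-! ### Conjugation by Gaussian unitaries -/

theorem sum_orthogonal_mul (Q : Matrix.orthogonalGroup (Fin (2 * n)) ℝ) (v w : Fin (2 * n)) :
    ∑ u, ((Q : Matrix (Fin (2 * n)) (Fin (2 * n)) ℝ) u v : ℂ) *
      ((Q : Matrix (Fin (2 * n)) (Fin (2 * n)) ℝ) u w : ℂ) = if v = w then 1 else 0 := by
  have h := congrFun (congrFun ((Matrix.mem_orthogonalGroup_iff' (Fin (2 * n)) ℝ).1 Q.2) v) w
  simp only [Matrix.mul_apply, Matrix.transpose_apply, Matrix.one_apply] at h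
  have h' := congrArg (fun r : ℝ => (r : ℂ)) h
  push_cast at h'
  rw [h']
  split_ifs <;> simp

namespace IsGaussianUnitary

variable {Q R : Matrix.orthogonalGroup (Fin (2 * n)) ℝ} {U V : Op n}

theorem mul_conjTranspose (hU : IsGaussianUnitary Q U) : U * Uᴴ = 1 :=
  Matrix.mem_unitaryGroup_iff.1 hU.1

theorem conjTranspose_mul (hU : IsGaussianUnitary Q U) : Uᴴ * U = 1 :=
  Matrix.mem_unitaryGroup_iff'.1 hU.1

theorem conj_list_prod (hU : IsGaussianUnitary Q U) (l : List (Op n)) :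
    Uᴴ * l.prod * U = (l.map fun A => Uᴴ * A * U).prod := by
  induction l with
  | nil => simp [hU.conjTranspose_mul]
  | cons A l ih =>
    rw [List.map_cons, List.prod_cons, List.prod_cons, ← ih]
    calc Uᴴ * (A * l.prod) * U = Uᴴ * A * 1 * l.prod * U := by simp only [mul_assoc, one_mul]
      _ = _ := by rw [← hU.mul_conjTranspose]; simp only [mul_assoc]

theorem conj_majoranaProd (hU : IsGaussianUnitary Q U) (S : Finset (Fin (2 * n))) :
    Uᴴ * majoranaProd S * U =
      (S.sort.map fun u => ∑ v, ((Q : Matrix _ _ ℝ) u v : ℂ) • majorana v).prod := by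
  unfold majoranaProd
  rw [hU.conj_list_prod, List.map_map]
  congr 1
  exact List.map_congr_left fun u _ => hU.2 u

/-- With the Heisenberg convention `U† γ U`, products of unitaries implement products of matrices in
the same order. -/
theorem mul (hU : IsGaussianUnitary Q U) (hV : IsGaussianUnitary R V) :
    IsGaussianUnitary (Q * R) (U * V) := by
  refine ⟨mul_mem hU.1 hV.1, fun u => ?_⟩
  calc (U * V)ᴴ * majorana u * (U * V) = Vᴴ * (Uᴴ * majorana u * U) * V := by
        rw [Matrix.conjTranspose_mul]; simp only [mul_assoc]
    _ = ∑ v, ((Q : Matrix _ _ ℝ) u v : ℂ) • (Vᴴ * majorana v * V) := by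
        rw [hU.2, Finset.mul_sum, Finset.sum_mul]
        simp
    _ = ∑ v, ∑ w, (((Q : Matrix (Fin (2 * n)) (Fin (2 * n)) ℝ) u v : ℂ) *
          ((R : Matrix (Fin (2 * n)) (Fin (2 * n)) ℝ) v w : ℂ)) •
          majorana w := by
        simp only [hV.2, Finset.smul_sum, smul_smul]
    _ = _ := by
        rw [Finset.sum_comm]
        refine Finset.sum_congr rfl fun w _ => ?_
        rw [← Finset.sum_smul]
        simp [Matrix.mul_apply]

theorem conjTranspose (hU : IsGaussianUnitary Q U) : IsGaussianUnitary Q⁻¹ Uᴴ := by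
  refine ⟨Unitary.star_mem hU.1, fun u => ?_⟩
  -- Orthonormality of the columns of `Q` inverts the action; conjugating back by `U` gives the
  -- claim.
  have key : Uᴴ * (∑ v, ((Q : Matrix _ _ ℝ) v u : ℂ) • majorana v) * U = majorana u := by
    rw [Finset.mul_sum, Finset.sum_mul]
    simp only [mul_smul_comm, smul_mul_assoc, hU.2, Finset.smul_sum, smul_smul]
    rw [Finset.sum_comm]
    simp only [← Finset.sum_smul]
    simp [sum_orthogonal_mul]
  rw [Matrix.conjTranspose_conjTranspose, ← key]
  calc U * (Uᴴ * (∑ v, ((Q : Matrix _ _ ℝ) v u : ℂ) • majorana v) * U) * Uᴴ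
      = (U * Uᴴ) * (∑ v, ((Q : Matrix _ _ ℝ) v u : ℂ) • majorana v) * (U * Uᴴ) := by
        simp only [mul_assoc]
    _ = _ := by
        rw [hU.mul_conjTranspose, one_mul, mul_one]
        rfl

end IsGaussianUnitary

/-- The orthogonal reflection in the `u`-th coordinate. -/
def coordReflection (u : Fin (2 * n)) : Matrix.orthogonalGroup (Fin (2 * n)) ℝ :=
  ⟨Matrix.diagonal fun v => if u = v then -1 else 1, by
    rw [Matrix.mem_orthogonalGroup_iff, Matrix.diagonal_transpose, Matrix.diagonal_mul_diagonal, ← Matrix.diagonal_one]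
    congr 1
    ext v
    by_cases h : u = v <;> simp [h]⟩

/-- The orthogonal permutation matrix sending the `u`-th row to the `σ u`-th coordinate. -/
def permOrthogonal (σ : Equiv.Perm (Fin (2 * n))) : Matrix.orthogonalGroup (Fin (2 * n)) ℝ :=
  ⟨σ.permMatrix ℝ, by
    rw [Matrix.mem_orthogonalGroup_iff, Matrix.transpose_permMatrix, ← Matrix.permMatrix_mul]
    simp⟩

/-- Only the factor `γ_u` changes sign, and it occurs at most once. -/
theorem conj_coordReflection {u : Fin (2 * n)} {U : Op n}
    (hU : IsGaussianUnitary (coordReflection u) U) (S : Finset (Fin (2 * n))) :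
    Uᴴ * majoranaProd S * U = (if u ∈ S then -1 else 1 : ℂ) • majoranaProd S := by
  have hm : ∀ v, Uᴴ * majorana v * U = (if u = v then -1 else 1 : ℂ) • majorana v := by
    intro v
    rw [hU.2, Finset.sum_eq_single v]
    · by_cases h : u = v <;> simp [coordReflection, h]
    · intro w _ hw
      simp [coordReflection, Matrix.diagonal_apply_ne _ hw.symm]
    · simp
  induction S using Finset.induction_on_min with
  | empty => simp [majoranaProd_empty, hU.conjTranspose_mul]
  | insert v S hv ih =>
    have hvS : v ∉ S := fun h => lt_irrefl _ (hv v h)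
    rw [majoranaProd_insert hv]
    calc Uᴴ * (majorana v * majoranaProd S) * U
        = (Uᴴ * majorana v * U) * (Uᴴ * majoranaProd S * U) := by
          have h : Uᴴ * (majorana v * majoranaProd S) * U =
            Uᴴ * majorana v * 1 * majoranaProd S * U := by simp only [mul_assoc, one_mul]
          rw [h, ← hU.mul_conjTranspose]
          simp only [mul_assoc]
      _ = _ := by
          rw [hm, ih, smul_mul_smul_comm]
          congr 1
          by_cases h : u = v
          · subst h; simp [hvS]
          · simp [h]

/-- Conjugation relabels the factors; restoring increasing order costs the scalar `ε`. -/
theorem conj_permOrthogonal {σ : Equiv.Perm (Fin (2 * n))} {U : Op n}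
    (hU : IsGaussianUnitary (permOrthogonal σ) U) (S : Finset (Fin (2 * n))) :
    ∃ ε : ℂ, ε ≠ 0 ∧
      Uᴴ * majoranaProd S * U = ε • majoranaProd (S.map σ.toEmbedding) := by
  have hm : ∀ v, ∑ w, (((permOrthogonal σ : Matrix _ _ ℝ) v w : ℝ) : ℂ) • majorana w =
      majorana (σ v) := by
    intro v
    rw [Finset.sum_eq_single (σ v)]
    · simp [permOrthogonal, Equiv.Perm.permMatrix, PEquiv.toMatrix_apply]
    · intro w _ hw
      simp [permOrthogonal, Equiv.Perm.permMatrix, PEquiv.toMatrix_apply, hw.symm]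
    · simp
  rw [hU.conj_majoranaProd]
  simp only [hm]
  have h : (S.sort.map fun u => majorana (σ u)) = (S.sort.map σ).map majorana := by
    simp
  rw [h]
  refine list_prod_perm ((List.perm_ext_iff_of_nodup ?_ ?_).2 fun v => ?_)
  · exact (S.sort_nodup _).map σ.injective
  · exact Finset.sort_nodup _ _
  · simp only [List.mem_map, Finset.mem_sort, Finset.mem_map, Equiv.coe_toEmbedding]

/-! ### The Majorana basis -/

/-- The coefficient of `γ_S` in the Majorana expansion of an operator. -/
def majoranaCoeff (S : Finset (Fin (2 * n))) : Op n →ₗ[ℂ] ℂ :=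
  (2 ^ n : ℂ)⁻¹ • Matrix.traceLinearMap (Bits n) ℂ ℂ ∘ₗ LinearMap.mulLeft ℂ (majoranaProd S)ᴴ

theorem majoranaCoeff_apply (S : Finset (Fin (2 * n))) (A : Op n) :
    majoranaCoeff S A = (2 ^ n : ℂ)⁻¹ * ((majoranaProd S)ᴴ * A).trace := rfl

theorem majoranaCoeff_self (S : Finset (Fin (2 * n))) :
    majoranaCoeff S (majoranaProd S) = 1 := by
  rw [majoranaCoeff_apply, conjTranspose_mul_majoranaProd, trace_one_op]
  exact inv_mul_cancel₀ (pow_ne_zero _ two_ne_zero)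

theorem IsGaussianUnitary.trace_conj {Q : Matrix.orthogonalGroup (Fin (2 * n)) ℝ} {U : Op n}
    (hU : IsGaussianUnitary Q U) (A B : Op n) :
    ((Uᴴ * A * U)ᴴ * (Uᴴ * B * U)).trace = (Aᴴ * B).trace := by
  have h : (Uᴴ * A * U)ᴴ * (Uᴴ * B * U) = Uᴴ * (Aᴴ * (U * Uᴴ) * B * U) := by
    simp only [Matrix.conjTranspose_mul, Matrix.conjTranspose_conjTranspose, mul_assoc]
  rw [h, Matrix.trace_mul_comm, hU.mul_conjTranspose, mul_one, mul_assoc,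
    hU.mul_conjTranspose, mul_one]

/-- Conjugation preserves the trace pairing and `γ_S` is an eigenvector with eigenvalue `±1`, so the
sign moves from one slot of the pairing to the other. -/
theorem IsGaussianUnitary.majoranaCoeff_conj
    {u : Fin (2 * n)} {U : Op n} (hU : IsGaussianUnitary (coordReflection u) U)
    (S : Finset (Fin (2 * n))) (A : Op n) :
    majoranaCoeff S (Uᴴ * A * U) = (if u ∈ S then -1 else 1 : ℂ) * majoranaCoeff S A := by
  have h := hU.trace_conj (majoranaProd S) A
  rw [conj_coordReflection hU] at h
  rw [majoranaCoeff_apply, majoranaCoeff_apply, ← h]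
  by_cases hu : u ∈ S <;> simp [hu]

/-- Reflecting in an index that lies in just one of `S`, `T` equates the coefficient with its
negative. -/
theorem majoranaCoeff_of_ne {S T : Finset (Fin (2 * n))} (h : S ≠ T) :
    majoranaCoeff S (majoranaProd T) = 0 := by
  obtain ⟨u, hu⟩ : ∃ u, ¬(u ∈ S ↔ u ∈ T) := by
    by_contra! h'
    exact h (Finset.ext h')
  have hU := gaussianUnitary_spec (coordReflection u)
  have h1 := hU.majoranaCoeff_conj S (majoranaProd T)
  rw [conj_coordReflection hU, map_smul, smul_eq_mul] at h1
  by_cases hS : u ∈ S <;> by_cases hT : u ∈ T <;> simp [hS, hT] at hu h1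
  · exact self_eq_neg.1 h1
  · exact neg_eq_self.1 h1

theorem majoranaCoeff_majoranaProd (S T : Finset (Fin (2 * n))) :
    majoranaCoeff S (majoranaProd T) = if S = T then 1 else 0 := by
  split_ifs with h
  · rw [h, majoranaCoeff_self]
  · exact majoranaCoeff_of_ne h

theorem linearIndependent_majoranaProd :
    LinearIndependent ℂ (majoranaProd : Finset (Fin (2 * n)) → Op n) := by
  rw [Fintype.linearIndependent_iff]
  intro g hg S
  have h := congrArg (majoranaCoeff S) hg
  simpa [map_sum, majoranaCoeff_majoranaProd] using h

/-- Dimension count: there are `2^(2n) = (2^n)^2` independent products. -/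
theorem span_majoranaProd :
    Submodule.span ℂ (Set.range (majoranaProd : Finset (Fin (2 * n)) → Op n)) = ⊤ := by
  refine linearIndependent_majoranaProd.span_eq_top_of_card_eq_finrank' ?_
  rw [Module.finrank_matrix]
  simp [Fintype.card_pi, two_mul, pow_add]

theorem majorana_expansion (A : Op n) :
    ∑ S, majoranaCoeff S A • majoranaProd S = A := by
  have hA : A ∈ Submodule.span ℂ (Set.range (majoranaProd : Finset (Fin (2 * n)) → Op n)) := by
    rw [span_majoranaProd]; trivial
  induction hA using Submodule.span_induction with
  | mem B hB =>
    obtain ⟨T, rfl⟩ := hB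
    simp [majoranaCoeff_majoranaProd]
  | zero => simp
  | add B C _ _ hB hC =>
    simp only [map_add, add_smul, Finset.sum_add_distrib, hB, hC]
  | smul c B _ hB =>
    simp only [map_smul, smul_assoc, ← Finset.smul_sum, hB]

theorem majoranaProjector_apply (k : ℕ) (A : Op n) :
    majoranaProjector n k A = ∑ S ∈ (Finset.univ : Finset (Fin (2 * n))).powersetCard k,
      majoranaCoeff S A • majoranaProd S := by
  refine Finset.sum_congr rfl fun S _ => ?_
  rw [majoranaProd_mul_conjTranspose, trace_one_op, majoranaCoeff_apply, div_eq_inv_mul]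

/-- The projector onto `Γ_k` as a linear map. -/
def projectorLinear (n k : ℕ) : Op n →ₗ[ℂ] Op n :=
  ∑ S ∈ (Finset.univ : Finset (Fin (2 * n))).powersetCard k,
    (majoranaCoeff S).smulRight (majoranaProd S)

theorem projectorLinear_apply (k : ℕ) (A : Op n) :
    projectorLinear n k A = majoranaProjector n k A := by
  simp [majoranaProjector_apply, projectorLinear]

theorem majoranaCoeff_projectorLinear (k : ℕ) (S : Finset (Fin (2 * n))) (A : Op n) :
    majoranaCoeff S (projectorLinear n k A) = if S.card = k then majoranaCoeff S A else 0 := by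
  rw [projectorLinear_apply, majoranaProjector_apply, map_sum]
  simp only [map_smul, majoranaCoeff_majoranaProd, smul_eq_mul, mul_ite, mul_one, mul_zero,
    Finset.sum_ite_eq, Finset.mem_powersetCard, Finset.subset_univ, true_and]

theorem projectorLinear_majoranaProd (k : ℕ) (S : Finset (Fin (2 * n))) :
    projectorLinear n k (majoranaProd S) = if S.card = k then majoranaProd S else 0 := by
  rw [projectorLinear_apply, majoranaProjector_apply]
  simp only [majoranaCoeff_majoranaProd, ite_smul, one_smul, zero_smul,
    Finset.sum_ite_eq', Finset.mem_powersetCard, Finset.subset_univ, true_and]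

theorem op_ext {A B : Op n} (h : ∀ S, majoranaCoeff S A = majoranaCoeff S B) : A = B := by
  rw [← majorana_expansion A, ← majorana_expansion B]
  simp only [h]

/-! ### Invariance of `Γ_k` under Gaussian unitaries -/

/-- The superoperator `A ↦ ∑_u γ_u A γ_u`, whose eigenspaces are the `Γ_k`. -/
def casimir : Op n →ₗ[ℂ] Op n :=
  ∑ u, LinearMap.mulRight ℂ (majorana u) ∘ₗ LinearMap.mulLeft ℂ (majorana u)

theorem casimir_apply (A : Op n) : casimir A = ∑ u, majorana u * A * majorana u := by
  simp [casimir]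

/-- The eigenvalue of `casimir` on `Γ_k`. -/
def casimirEigenvalue (n k : ℕ) : ℤ := (-1) ^ k * (2 * n - 2 * k)

/-- Up to the common sign `(-1)^|S|`, the `2n - |S|` indices outside `S` contribute `+1` and the
`|S|` indices inside contribute `-1`. -/
theorem casimir_majoranaProd (S : Finset (Fin (2 * n))) :
    casimir (majoranaProd S) = (casimirEigenvalue n S.card : ℂ) • majoranaProd S := by
  rw [casimir_apply]
  simp only [majorana_mul_majoranaProd_mul, ← Finset.sum_smul, ← Finset.mul_sum]
  congr 1
  have h : ∀ u, (if u ∈ S then -1 else 1 : ℂ) = 1 - 2 * if u ∈ S then 1 else 0 := by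
    intro u; split_ifs <;> norm_num
  simp only [h, Finset.sum_sub_distrib, ← Finset.mul_sum]
  simp [casimirEigenvalue]

/-- For `k`, `l` of equal parity the signs agree. For opposite parity, equality would force `k + l =
2n`, which is even. -/
theorem casimirEigenvalue_injective {k l : ℕ}
    (h : casimirEigenvalue n k = casimirEigenvalue n l) : k = l := by
  unfold casimirEigenvalue at h
  rcases Nat.even_or_odd' k with ⟨a, rfl | rfl⟩ <;> rcases Nat.even_or_odd' l with ⟨b, rfl | rfl⟩ <;>
    simp [pow_add, pow_mul] at h ⊢ <;> omega

theorem majoranaCoeff_casimir (S : Finset (Fin (2 * n))) (A : Op n) :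
    majoranaCoeff S (casimir A) = casimirEigenvalue n S.card * majoranaCoeff S A := by
  conv_lhs => rw [← majorana_expansion A]
  simp only [map_sum, map_smul, casimir_majoranaProd, majoranaCoeff_majoranaProd, smul_eq_mul]
  simp [mul_comm]

/-- The tensor `∑_u γ_u ⊗ γ_u` is invariant under orthogonal changes of the `γ_u`. -/
theorem IsGaussianUnitary.casimir_conj {Q : Matrix.orthogonalGroup (Fin (2 * n)) ℝ} {U : Op n}
    (hU : IsGaussianUnitary Q U) (A : Op n) :
    casimir (U * A * Uᴴ) = U * casimir A * Uᴴ := by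
  have h1 : ∀ u, majorana u * (U * A * Uᴴ) * majorana u =
      U * ((Uᴴ * majorana u * U) * A * (Uᴴ * majorana u * U)) * Uᴴ := by
    intro u
    calc majorana u * (U * A * Uᴴ) * majorana u
        = 1 * majorana u * (U * A * Uᴴ) * majorana u * 1 := by rw [one_mul, mul_one]
      _ = _ := by rw [← hU.mul_conjTranspose]; simp only [mul_assoc]
  rw [casimir_apply, casimir_apply]
  simp only [h1]
  rw [← Finset.sum_mul, ← Finset.mul_sum]
  congr 2
  calc ∑ u, (Uᴴ * majorana u * U) * A * (Uᴴ * majorana u * U)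
      = ∑ u, ∑ w, ∑ v, (((Q : Matrix (Fin (2 * n)) (Fin (2 * n)) ℝ) u v : ℂ) *
          ((Q : Matrix (Fin (2 * n)) (Fin (2 * n)) ℝ) u w : ℂ)) •
            (majorana v * A * majorana w) := by
        refine Finset.sum_congr rfl fun u _ => ?_
        rw [hU.2, Finset.sum_mul, Finset.mul_sum]
        refine Finset.sum_congr rfl fun w _ => ?_
        rw [Finset.sum_mul]
        refine Finset.sum_congr rfl fun v _ => ?_
        rw [smul_mul_assoc, smul_mul_smul_comm]
    _ = ∑ w, ∑ v, (∑ u, ((Q : Matrix (Fin (2 * n)) (Fin (2 * n)) ℝ) u v : ℂ) *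
          ((Q : Matrix (Fin (2 * n)) (Fin (2 * n)) ℝ) u w : ℂ)) •
            (majorana v * A * majorana w) := by
        rw [Finset.sum_comm]
        refine Finset.sum_congr rfl fun w _ => ?_
        rw [Finset.sum_comm]
        refine Finset.sum_congr rfl fun v _ => ?_
        rw [Finset.sum_smul]
    _ = _ := by simp [sum_orthogonal_mul]

/-- `U γ_T U†` stays in the Casimir eigenspace of `γ_T`, and different degrees have different
eigenvalues. This avoids expanding a product of rotated Majoranas into minors. -/
theorem IsGaussianUnitary.majoranaCoeff_conj_of_card_ne
    {Q : Matrix.orthogonalGroup (Fin (2 * n)) ℝ} {U : Op n}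
    (hU : IsGaussianUnitary Q U) {S T : Finset (Fin (2 * n))} (h : S.card ≠ T.card) :
    majoranaCoeff S (U * majoranaProd T * Uᴴ) = 0 := by
  have h1 := majoranaCoeff_casimir S (U * majoranaProd T * Uᴴ)
  rw [hU.casimir_conj, casimir_majoranaProd, mul_smul_comm, smul_mul_assoc, map_smul,
    smul_eq_mul] at h1
  by_contra h0
  exact h (casimirEigenvalue_injective (n := n) (Int.cast_injective (mul_right_cancel₀ h0 h1))).symm

/-- Conjugation `A ↦ U A U†` as a linear map. -/
def conjLinear (U : Op n) : Op n →ₗ[ℂ] Op n :=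
  LinearMap.mulRight ℂ Uᴴ ∘ₗ LinearMap.mulLeft ℂ U

theorem conjLinear_apply (U A : Op n) : conjLinear U A = U * A * Uᴴ := rfl

theorem IsGaussianUnitary.projectorLinear_comp_conjLinear
    {Q : Matrix.orthogonalGroup (Fin (2 * n)) ℝ} {U : Op n}
    (hU : IsGaussianUnitary Q U) (k : ℕ) :
    projectorLinear n k ∘ₗ conjLinear U = conjLinear U ∘ₗ projectorLinear n k := by
  have key : ∀ T : Finset (Fin (2 * n)), projectorLinear n k (conjLinear U (majoranaProd T)) =
      conjLinear U (projectorLinear n k (majoranaProd T)) := by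
    intro T
    refine op_ext fun S => ?_
    rw [majoranaCoeff_projectorLinear, projectorLinear_majoranaProd, conjLinear_apply]
    by_cases hST : S.card = T.card
    · by_cases hT : T.card = k <;> simp [hST, hT, conjLinear_apply]
    · rw [hU.majoranaCoeff_conj_of_card_ne hST]
      split_ifs <;> simp [conjLinear_apply, hU.majoranaCoeff_conj_of_card_ne hST]
  refine LinearMap.ext fun A => ?_
  rw [← majorana_expansion A]
  simp only [map_sum, map_smul, LinearMap.comp_apply, key]

theorem trace_comp_projectorLinear (K : Op n →ₗ[ℂ] Op n) (k : ℕ) :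
    LinearMap.trace ℂ (Op n) (K ∘ₗ projectorLinear n k) =
      ∑ S ∈ (Finset.univ : Finset (Fin (2 * n))).powersetCard k,
        majoranaCoeff S (K (majoranaProd S)) := by
  have h : K ∘ₗ projectorLinear n k = ∑ S ∈ (Finset.univ : Finset (Fin (2 * n))).powersetCard k,
      (majoranaCoeff S).smulRight (K (majoranaProd S)) := by
    refine LinearMap.ext fun A => ?_
    simp [projectorLinear]
  rw [h, map_sum]
  simp only [LinearMap.trace_smulRight]

/-- The trace of a superoperator over `Γ_k` is invariant under conjugation by a Gaussian
unitary channel. -/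
theorem IsGaussianUnitary.sum_majoranaCoeff_conj
    {Q : Matrix.orthogonalGroup (Fin (2 * n)) ℝ} {U : Op n}
    (hU : IsGaussianUnitary Q U) (K : Op n →ₗ[ℂ] Op n) (k : ℕ) :
    ∑ S ∈ (Finset.univ : Finset (Fin (2 * n))).powersetCard k,
        majoranaCoeff S (conjLinear Uᴴ (K (conjLinear U (majoranaProd S)))) =
      ∑ S ∈ (Finset.univ : Finset (Fin (2 * n))).powersetCard k,
        majoranaCoeff S (K (majoranaProd S)) := by
  have hid : conjLinear U ∘ₗ conjLinear Uᴴ = LinearMap.id := by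
    refine LinearMap.ext fun A => ?_
    simp only [LinearMap.comp_apply, conjLinear_apply, Matrix.conjTranspose_conjTranspose,
      LinearMap.id_apply]
    rw [← mul_assoc, ← mul_assoc, hU.mul_conjTranspose, one_mul, mul_assoc,
      hU.mul_conjTranspose, mul_one]
  have h := trace_comp_projectorLinear (conjLinear Uᴴ ∘ₗ (K ∘ₗ conjLinear U)) k
  simp only [LinearMap.comp_apply] at h
  -- Cyclicity brings `𝒰†` to the far right; the projector commutes with `𝒰`, after which `𝒰 ∘ 𝒰†`
  -- cancels.
  rw [← h, ← trace_comp_projectorLinear, LinearMap.comp_assoc, LinearMap.trace_comp_comm',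
    LinearMap.comp_assoc, ← LinearMap.comp_assoc (conjLinear Uᴴ),
    LinearMap.comp_assoc (projectorLinear n k), ← hU.projectorLinear_comp_conjLinear,
    LinearMap.comp_assoc, LinearMap.comp_assoc, hid, LinearMap.comp_id]

/-! ### Diagonal matrix elements of Majorana products -/

/-- The operator `(-1)^{x_j}`. -/
def signOp (j : Fin n) : Op n := Matrix.diagonal fun x => (-1) ^ (x j : ℕ)

/-- `γ_u` flips exactly the bit of its own mode. -/
theorem signOp_mul_majorana (j : Fin n) (u : Fin (2 * n)) :
    signOp j * majorana u = (if modeOf u = j then -1 else 1 : ℂ) • (majorana u * signOp j) := by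
  ext y x
  rw [Matrix.smul_apply, signOp, Matrix.diagonal_mul, Matrix.mul_diagonal, majorana_apply]
  by_cases h : y = flipAt (modeOf u) x
  · subst h
    by_cases hj : modeOf u = j
    · subst hj
      simp [flipAt_self, sign_flip, mul_comm]
    · simp [hj, flipAt_ne (Ne.symm hj), mul_comm]
  · simp [h]

theorem signOp_mul_majoranaProd (j : Fin n) (S : Finset (Fin (2 * n))) :
    signOp j * majoranaProd S =
      (∏ u ∈ S, if modeOf u = j then -1 else 1 : ℂ) • (majoranaProd S * signOp j) := by
  induction S using Finset.induction_on_min with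
  | empty => simp [majoranaProd_empty]
  | insert v S hv ih =>
    have hvS : v ∉ S := fun h => lt_irrefl _ (hv v h)
    rw [majoranaProd_insert hv, ← mul_assoc, signOp_mul_majorana, smul_mul_assoc, mul_assoc, ih,
      mul_smul_comm, smul_smul, Finset.prod_insert hvS, mul_assoc]

/-- The first Majorana index of a mode. -/
def evenIndex (j : Fin n) : Fin (2 * n) := ⟨2 * j, by omega⟩

/-- The second Majorana index of a mode. -/
def oddIndex (j : Fin n) : Fin (2 * n) := ⟨2 * j + 1, by omega⟩

theorem modeOf_eq_iff {u : Fin (2 * n)} {j : Fin n} :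
    modeOf u = j ↔ u = evenIndex j ∨ u = oddIndex j := by
  simp only [modeOf, evenIndex, oddIndex, Fin.ext_iff]
  omega

theorem modeOf_evenIndex (j : Fin n) : modeOf (evenIndex j) = j :=
  modeOf_eq_iff.2 (Or.inl rfl)

theorem modeOf_oddIndex (j : Fin n) : modeOf (oddIndex j) = j :=
  modeOf_eq_iff.2 (Or.inr rfl)

theorem mem_pairs {S : Finset (Fin n)} {u : Fin (2 * n)} : u ∈ pairs S ↔ modeOf u ∈ S := by
  simp [pairs]

theorem pairs_injective : Function.Injective (pairs : Finset (Fin n) → _) := by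
  intro S T h
  ext j
  rw [← modeOf_evenIndex j, ← mem_pairs, h, mem_pairs]

theorem pairs_insert (j : Fin n) (S : Finset (Fin n)) :
    pairs (insert j S) = insert (evenIndex j) (insert (oddIndex j) (pairs S)) := by
  ext u
  simp only [mem_pairs, Finset.mem_insert, modeOf_eq_iff, or_assoc]

theorem evenIndex_lt_oddIndex (j : Fin n) : evenIndex j < oddIndex j := by
  simp [evenIndex, oddIndex, Fin.lt_def]

theorem oddIndex_lt_of_mem_pairs {j : Fin n} {S : Finset (Fin n)} (h : ∀ i ∈ S, j < i)
    {u : Fin (2 * n)} (hu : u ∈ pairs S) : oddIndex j < u := by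
  have := h _ (mem_pairs.1 hu)
  simp only [Fin.lt_def, modeOf, oddIndex] at this ⊢
  omega

theorem card_pairs (S : Finset (Fin n)) : (pairs S).card = 2 * S.card := by
  induction S using Finset.induction_on with
  | empty => simp [pairs]
  | insert j S hj ih =>
    have h1 : oddIndex j ∉ pairs S := by rwa [mem_pairs, modeOf_oddIndex]
    have h2 : evenIndex j ∉ insert (oddIndex j) (pairs S) := by
      rw [Finset.mem_insert, mem_pairs, modeOf_evenIndex]
      exact not_or.2 ⟨(evenIndex_lt_oddIndex j).ne, hj⟩
    rw [pairs_insert, Finset.card_insert_of_notMem h2, Finset.card_insert_of_notMem h1, ih,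
      Finset.card_insert_of_notMem hj]
    ring

theorem majorana_evenIndex_mul_oddIndex (j : Fin n) :
    majorana (evenIndex j) * majorana (oddIndex j) =
      Matrix.diagonal fun x => Complex.I * (-1) ^ (x j : ℕ) := by
  ext y x
  rw [majorana_mul_apply, modeOf_evenIndex, modeOf_oddIndex, flipAt_flipAt]
  have h1 : majCoeff (evenIndex j) (flipAt j x) = jwSign j x := by
    unfold majCoeff
    rw [if_pos (by simp [evenIndex]), modeOf_evenIndex, jwSign_flipAt_of_le le_rfl]
  have h2 : majCoeff (oddIndex j) x = Complex.I * (-1) ^ (x j : ℕ) * jwSign j x := by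
    unfold majCoeff
    rw [if_neg (by simp [oddIndex]), modeOf_oddIndex]
  rw [h1, h2, Matrix.diagonal_apply]
  split_ifs with h
  · subst h
    linear_combination (Complex.I * (-1) ^ (y j : ℕ)) * jwSign_mul_self j y
  · rfl

/-- The two indices of a mode are adjacent in the ordering, so `γ_{D(S)}` is a product of the
diagonal factors `i(-1)^{x_j}` with no reordering sign. -/
theorem majoranaProd_pairs (S : Finset (Fin n)) :
    majoranaProd (pairs S) = Matrix.diagonal fun x : Bits n =>
      Complex.I ^ S.card * (-1) ^ (∑ j ∈ S, (x j : ℕ)) := by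
  induction S using Finset.induction_on_min with
  | empty => simp [pairs, majoranaProd_empty]
  | insert j S hj ih =>
    have hjS : j ∉ S := fun h => lt_irrefl _ (hj j h)
    have h1 : ∀ u ∈ pairs S, oddIndex j < u := fun u hu => oddIndex_lt_of_mem_pairs hj hu
    have h2 : ∀ u ∈ insert (oddIndex j) (pairs S), evenIndex j < u := by
      intro u hu
      rcases Finset.mem_insert.1 hu with rfl | hu
      · exact evenIndex_lt_oddIndex j
      · exact (evenIndex_lt_oddIndex j).trans (h1 u hu)
    rw [pairs_insert, majoranaProd_insert h2, majoranaProd_insert h1, ← mul_assoc,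
      majorana_evenIndex_mul_oddIndex, ih, Matrix.diagonal_mul_diagonal]
    congr 1
    ext x
    rw [Finset.card_insert_of_notMem hjS, Finset.sum_insert hjS]
    ring

/-- Some mode `j` has exactly one of its indices in `S`, so `γ_S` anticommutes with the diagonal
operator `(-1)^{x_j}`, and each diagonal entry is its own negative. -/
theorem majoranaProd_diag_eq_zero {S : Finset (Fin (2 * n))} (hS : S ∉ Set.range pairs)
    (x : Bits n) : majoranaProd S x x = 0 := by
  obtain ⟨j, hj⟩ : ∃ j, ¬(evenIndex j ∈ S ↔ oddIndex j ∈ S) := by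
    by_contra! h
    refine hS ⟨Finset.univ.filter fun j => evenIndex j ∈ S, ?_⟩
    ext u
    rw [mem_pairs, Finset.mem_filter]
    rcases (modeOf_eq_iff (u := u)).1 rfl with hu | hu
    · rw [← hu]; simp
    · rw [h, ← hu]; simp
  have hp : (∏ u ∈ S, if modeOf u = j then -1 else 1 : ℂ) = -1 := by
    by_cases he : evenIndex j ∈ S
    · have ho : oddIndex j ∉ S := fun ho => hj (iff_of_true he ho)
      rw [Finset.prod_eq_single_of_mem _ he, if_pos (modeOf_evenIndex j)]
      intro u hu hne
      refine if_neg fun h => ?_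
      rcases modeOf_eq_iff.1 h with rfl | rfl
      exacts [hne rfl, ho hu]
    · have ho : oddIndex j ∈ S := by
        by_contra ho
        exact hj (iff_of_false he ho)
      rw [Finset.prod_eq_single_of_mem _ ho, if_pos (modeOf_oddIndex j)]
      intro u hu hne
      refine if_neg fun h => ?_
      rcases modeOf_eq_iff.1 h with rfl | rfl
      exacts [he hu, hne rfl]
  have h := congrFun (congrFun (signOp_mul_majoranaProd j S) x) x
  rw [hp, Matrix.smul_apply, signOp, Matrix.diagonal_mul, Matrix.mul_diagonal, neg_one_smul,
    mul_comm] at h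
  rcases mul_eq_zero.1 (self_eq_neg.1 h) with h | h
  · exact h
  · exact absurd h (pow_ne_zero _ (by simp))

/-! ### Haar measure -/

instance isHaarMeasure_orthHaar (m : ℕ) : (orthHaar m).IsHaarMeasure :=
  inferInstanceAs (Measure.haarMeasure _).IsHaarMeasure

instance isProbabilityMeasure_orthHaar (m : ℕ) : IsProbabilityMeasure (orthHaar m) :=
  ⟨Measure.haarMeasure_self (K₀ := ⊤)⟩

/-- Compact groups are unimodular: a right translate is again a Haar probability measure, hence the
same one. -/
instance isMulRightInvariant_orthHaar (m : ℕ) : (orthHaar m).IsMulRightInvariant where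
  map_mul_right_eq_self g := by
    have : IsProbabilityMeasure ((orthHaar m).map (· * g)) :=
      Measure.isProbabilityMeasure_map (by fun_prop)
    exact Measure.isHaarMeasure_eq_of_isProbabilityMeasure _ _

theorem integrable_orthHaar {m : ℕ} {f : Matrix.orthogonalGroup (Fin m) ℝ → ℂ}
    (hf : Continuous f) : Integrable f (orthHaar m) :=
  hf.integrable_of_hasCompactSupport (HasCompactSupport.of_compactSpace _)

/-! ### Continuity of the Gaussian unitary channels -/

/-- The image of `γ_S` under the Heisenberg action of an orthogonal matrix. -/
def rotatedMajorana (S : Finset (Fin (2 * n))) (Q : Matrix.orthogonalGroup (Fin (2 * n)) ℝ) :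
    Op n :=
  (S.sort.map fun u => ∑ v, ((Q : Matrix (Fin (2 * n)) (Fin (2 * n)) ℝ) u v : ℂ) •
    majorana v).prod

theorem continuous_rotatedMajorana (S : Finset (Fin (2 * n))) :
    Continuous (rotatedMajorana S) := by
  refine continuous_list_prod _ fun u _ => continuous_finsetSum _ fun v _ => ?_
  refine Continuous.smul (Complex.continuous_ofReal.comp ?_) continuous_const
  exact continuous_subtype_val.matrix_elem u v

/-- The chosen `U_Q` need not vary continuously with `Q`, its phase being arbitrary. The channel it
induces is polynomial in the entries of `Q`, which gives continuity and independence of the choice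
of `U`. -/
theorem IsGaussianUnitary.conjLinear_conjTranspose
    {Q : Matrix.orthogonalGroup (Fin (2 * n)) ℝ} {U : Op n}
    (hU : IsGaussianUnitary Q U) (A : Op n) :
    conjLinear Uᴴ A = ∑ S, majoranaCoeff S A • rotatedMajorana S Q := by
  conv_lhs => rw [← majorana_expansion A]
  rw [map_sum]
  refine Finset.sum_congr rfl fun S _ => ?_
  rw [map_smul, conjLinear_apply, Matrix.conjTranspose_conjTranspose, hU.conj_majoranaProd]
  rfl

theorem continuous_linearMap {E : Type*} [AddCommGroup E] [Module ℂ E] [TopologicalSpace E]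
    [IsTopologicalAddGroup E] [ContinuousSMul ℂ E] (φ : Op n →ₗ[ℂ] E) : Continuous φ :=
  LinearMap.continuous_of_finiteDimensional φ

theorem continuous_conj_conjTranspose
    {B : Matrix.orthogonalGroup (Fin (2 * n)) ℝ → Op n} (hB : Continuous B) :
    Continuous fun Q => conjLinear (gaussianUnitary Q)ᴴ (B Q) := by
  simp only [(gaussianUnitary_spec _).conjLinear_conjTranspose]
  refine continuous_finsetSum _ fun S _ => Continuous.fun_smul ?_ (continuous_rotatedMajorana S)
  exact (continuous_linearMap (majoranaCoeff S)).comp hB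

theorem continuous_conj (A : Op n) :
    Continuous fun Q : Matrix.orthogonalGroup (Fin (2 * n)) ℝ =>
      conjLinear (gaussianUnitary Q) A := by
  have h : ∀ Q : Matrix.orthogonalGroup (Fin (2 * n)) ℝ, conjLinear (gaussianUnitary Q) A =
      ∑ S, majoranaCoeff S A • rotatedMajorana S Q⁻¹ := by
    intro Q
    rw [← (gaussianUnitary_spec Q).conjTranspose.conjLinear_conjTranspose,
      Matrix.conjTranspose_conjTranspose]
  simp only [h]
  refine continuous_finsetSum _ fun S _ => Continuous.fun_smul continuous_const ?_
  exact (continuous_rotatedMajorana S).comp continuous_inv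

/-! ### Twirling -/

/-- The superoperator `𝒰_Q† ∘ K ∘ 𝒰_Q`. -/
def conjSuper (K : Op n →ₗ[ℂ] Op n) (Q : Matrix.orthogonalGroup (Fin (2 * n)) ℝ) :
    Op n →ₗ[ℂ] Op n :=
  conjLinear (gaussianUnitary Q)ᴴ ∘ₗ K ∘ₗ conjLinear (gaussianUnitary Q)

theorem continuous_conjSuper (K : Op n →ₗ[ℂ] Op n) (A : Op n) :
    Continuous fun Q => conjSuper K Q A :=
  continuous_conj_conjTranspose ((continuous_linearMap K).comp (continuous_conj A))

theorem integrable_conjSuper (K : Op n →ₗ[ℂ] Op n) (A : Op n) (φ : Op n →ₗ[ℂ] ℂ) :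
    Integrable (fun Q => φ (conjSuper K Q A)) (orthHaar (2 * n)) :=
  integrable_orthHaar ((continuous_linearMap φ).comp (continuous_conjSuper K A))

theorem integrable_conjSuper_entry (K : Op n →ₗ[ℂ] Op n) (A : Op n) (y z : Bits n) :
    Integrable (fun Q => conjSuper K Q A y z) (orthHaar (2 * n)) :=
  integrable_orthHaar ((continuous_conjSuper K A).matrix_elem y z)

/-- The twirl `∫ 𝒰_Q† ∘ K ∘ 𝒰_Q dμ(Q)` of a superoperator. -/
def twirl (K : Op n →ₗ[ℂ] Op n) : Op n →ₗ[ℂ] Op n where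
  toFun A := Matrix.of fun y z => ∫ Q, conjSuper K Q A y z ∂(orthHaar (2 * n))
  map_add' A B := by
    ext y z
    simp only [map_add, Matrix.of_apply, Matrix.add_apply]
    exact integral_add (integrable_conjSuper_entry K A y z) (integrable_conjSuper_entry K B y z)
  map_smul' c A := by
    ext y z
    simp only [map_smul, Matrix.of_apply, Matrix.smul_apply, RingHom.id_apply]
    exact integral_smul c _

theorem twirl_apply (K : Op n →ₗ[ℂ] Op n) (A : Op n) (y z : Bits n) :
    twirl K A y z = ∫ Q, conjSuper K Q A y z ∂(orthHaar (2 * n)) := rfl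

/-- A functional is a finite combination of matrix entries, so it passes through the entrywise
integral. -/
theorem map_twirl (K : Op n →ₗ[ℂ] Op n) (A : Op n) (φ : Op n →ₗ[ℂ] ℂ) :
    φ (twirl K A) = ∫ Q, φ (conjSuper K Q A) ∂(orthHaar (2 * n)) := by
  have hφ : ∀ M : Op n, φ M = ∑ y, ∑ z, M y z * φ (Matrix.single y z 1) := by
    intro M
    conv_lhs => rw [Matrix.matrix_eq_sum_single M]
    simp only [map_sum]
    refine Finset.sum_congr rfl fun y _ => Finset.sum_congr rfl fun z _ => ?_
    rw [← smul_eq_mul, ← map_smul, Matrix.smul_single, smul_eq_mul, mul_one]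
  have hi : ∀ y z, Integrable (fun Q => conjSuper K Q A y z * φ (Matrix.single y z 1))
      (orthHaar (2 * n)) := fun y z => (integrable_conjSuper_entry K A y z).mul_const _
  rw [hφ]
  simp only [hφ (conjSuper K _ A)]
  rw [integral_finsetSum _ fun y _ => integrable_finsetSum _ fun z _ => hi y z]
  refine Finset.sum_congr rfl fun y _ => ?_
  rw [integral_finsetSum _ fun z _ => hi y z]
  refine Finset.sum_congr rfl fun z _ => ?_
  rw [integral_mul_const, twirl_apply]

/-- `U_{QR}` and `U_Q U_R` implement the same matrix, so they define the same channel. -/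
theorem conjSuper_mul (K : Op n →ₗ[ℂ] Op n) (Q R : Matrix.orthogonalGroup (Fin (2 * n)) ℝ)
    (A : Op n) :
    conjSuper K (Q * R) A =
      conjLinear (gaussianUnitary R)ᴴ (conjSuper K Q (conjLinear (gaussianUnitary R) A)) := by
  have hQR := (gaussianUnitary_spec Q).mul (gaussianUnitary_spec R)
  have h1 : ∀ B, conjLinear (gaussianUnitary (Q * R))ᴴ B =
      conjLinear (gaussianUnitary R)ᴴ (conjLinear (gaussianUnitary Q)ᴴ B) := by
    intro B
    rw [(gaussianUnitary_spec (Q * R)).conjLinear_conjTranspose,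
      ← hQR.conjLinear_conjTranspose]
    simp only [conjLinear_apply, Matrix.conjTranspose_mul, Matrix.conjTranspose_conjTranspose,
      mul_assoc]
  have h2 : conjLinear (gaussianUnitary (Q * R)) A =
      conjLinear (gaussianUnitary Q) (conjLinear (gaussianUnitary R) A) := by
    have h := (gaussianUnitary_spec (Q * R)).conjTranspose.conjLinear_conjTranspose A
    rw [← hQR.conjTranspose.conjLinear_conjTranspose, Matrix.conjTranspose_conjTranspose,
      Matrix.conjTranspose_conjTranspose] at h
    rw [h]
    simp only [conjLinear_apply, Matrix.conjTranspose_mul, mul_assoc]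
  simp only [conjSuper, LinearMap.comp_apply, h1, h2]

/-- The outer conjugations turn the integrand at `Q` into the one at `Q * R`; right invariance of
the measure absorbs `R`. -/
theorem conj_twirl_conj (K : Op n →ₗ[ℂ] Op n) (R : Matrix.orthogonalGroup (Fin (2 * n)) ℝ)
    (A : Op n) :
    conjLinear (gaussianUnitary R)ᴴ (twirl K (conjLinear (gaussianUnitary R) A)) =
      twirl K A := by
  refine op_ext fun S => ?_
  have h := map_twirl K (conjLinear (gaussianUnitary R) A)
    (majoranaCoeff S ∘ₗ conjLinear (gaussianUnitary R)ᴴ)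
  simp only [LinearMap.comp_apply, ← conjSuper_mul] at h
  rw [h, map_twirl]
  exact integral_mul_right_eq_self (fun Q => majoranaCoeff S (conjSuper K Q A)) R

theorem twirl_conj (K : Op n →ₗ[ℂ] Op n) (R : Matrix.orthogonalGroup (Fin (2 * n)) ℝ)
    (A : Op n) :
    twirl K ((gaussianUnitary R)ᴴ * A * gaussianUnitary R) =
      (gaussianUnitary R)ᴴ * twirl K A * gaussianUnitary R := by
  have hR := (gaussianUnitary_spec R).mul_conjTranspose
  rw [← conj_twirl_conj K R]
  have h : conjLinear (gaussianUnitary R) ((gaussianUnitary R)ᴴ * A * gaussianUnitary R) = A := by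
    rw [conjLinear_apply]
    simp only [mul_assoc, hR, mul_one]
    rw [← mul_assoc, hR, one_mul]
  rw [h, conjLinear_apply, Matrix.conjTranspose_conjTranspose]

/-- Same sign argument as for orthogonality of the `γ_S`. Determinant `-1` matters here: even
numbers of reflections would not separate `S` from its complement. -/
theorem majoranaCoeff_twirl_of_ne (K : Op n →ₗ[ℂ] Op n) {S T : Finset (Fin (2 * n))}
    (h : S ≠ T) : majoranaCoeff S (twirl K (majoranaProd T)) = 0 := by
  obtain ⟨u, hu⟩ : ∃ u, ¬(u ∈ S ↔ u ∈ T) := by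
    by_contra! h'
    exact h (Finset.ext h')
  have hU := gaussianUnitary_spec (coordReflection u)
  have h1 := hU.majoranaCoeff_conj S (twirl K (majoranaProd T))
  rw [← twirl_conj, conj_coordReflection hU, map_smul, map_smul, smul_eq_mul] at h1
  by_cases hS : u ∈ S <;> by_cases hT : u ∈ T <;> simp [hS, hT] at hu h1
  · exact self_eq_neg.1 h1
  · exact neg_eq_self.1 h1

theorem twirl_majoranaProd (K : Op n →ₗ[ℂ] Op n) (S : Finset (Fin (2 * n))) :
    twirl K (majoranaProd S) = majoranaCoeff S (twirl K (majoranaProd S)) • majoranaProd S := by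
  refine op_ext fun T => ?_
  rw [map_smul, majoranaCoeff_majoranaProd]
  split_ifs with h
  · rw [h, smul_eq_mul, mul_one]
  · rw [majoranaCoeff_twirl_of_ne K h, smul_zero]

theorem majoranaCoeff_twirl_eq_of_card_eq (K : Op n →ₗ[ℂ] Op n) {S T : Finset (Fin (2 * n))}
    (h : S.card = T.card) :
    majoranaCoeff S (twirl K (majoranaProd S)) = majoranaCoeff T (twirl K (majoranaProd T)) := by
  -- Any bijection from `S` to `T` extends to a permutation of all indices.
  obtain ⟨σ, rfl⟩ : ∃ σ : Equiv.Perm (Fin (2 * n)), S.map σ.toEmbedding = T := by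
    let e : {x // x ∈ S} ≃ {x // x ∈ T} := S.equivOfCardEq h
    refine ⟨e.extendSubtype, Finset.eq_of_subset_of_card_le (fun v hv => ?_) ?_⟩
    · obtain ⟨u, hu, rfl⟩ := Finset.mem_map.1 hv
      exact e.extendSubtype_mem u hu
    · rw [Finset.card_map, h]
  have hU := gaussianUnitary_spec (permOrthogonal σ)
  obtain ⟨ε, hε, h1⟩ := conj_permOrthogonal hU S
  have h2 := twirl_conj K (permOrthogonal σ) (majoranaProd S)
  rw [twirl_majoranaProd K S, mul_smul_comm, smul_mul_assoc, h1, map_smul] at h2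
  -- Both sides are multiples of `γ_T`; comparing coefficients and cancelling `ε` equates the
  -- eigenvalues.
  have h3 := congrArg (majoranaCoeff (S.map σ.toEmbedding)) h2
  simp only [map_smul, majoranaCoeff_self, smul_eq_mul, mul_one] at h3
  rw [mul_comm] at h3
  exact (mul_right_cancel₀ hε h3).symm

/-- The trace over `Γ_k` of the integrand does not depend on `Q`, and the measure has mass one. -/
theorem sum_majoranaCoeff_twirl (K : Op n →ₗ[ℂ] Op n) (k : ℕ) :
    ∑ S ∈ (Finset.univ : Finset (Fin (2 * n))).powersetCard k,
        majoranaCoeff S (twirl K (majoranaProd S)) =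
      ∑ S ∈ (Finset.univ : Finset (Fin (2 * n))).powersetCard k,
        majoranaCoeff S (K (majoranaProd S)) := by
  simp only [map_twirl]
  rw [← integral_finsetSum _ fun S _ => integrable_conjSuper K _ _]
  have h : ∀ Q : Matrix.orthogonalGroup (Fin (2 * n)) ℝ,
      ∑ S ∈ (Finset.univ : Finset (Fin (2 * n))).powersetCard k,
        majoranaCoeff S (conjSuper K Q (majoranaProd S)) =
      ∑ S ∈ (Finset.univ : Finset (Fin (2 * n))).powersetCard k,
        majoranaCoeff S (K (majoranaProd S)) := fun Q =>
    (gaussianUnitary_spec Q).sum_majoranaCoeff_conj K k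
  simp [h]

/-- The eigenvalue of the twirl of `K` on `Γ_k`: the normalised trace of `K` over `Γ_k`. -/
def twirlCoeff (K : Op n →ₗ[ℂ] Op n) (k : ℕ) : ℂ :=
  ((2 * n).choose k : ℂ)⁻¹ * ∑ S ∈ (Finset.univ : Finset (Fin (2 * n))).powersetCard k,
    majoranaCoeff S (K (majoranaProd S))

theorem twirl_majoranaProd_eq (K : Op n →ₗ[ℂ] Op n) (S : Finset (Fin (2 * n))) :
    twirl K (majoranaProd S) = twirlCoeff K S.card • majoranaProd S := by
  rw [twirl_majoranaProd]
  congr 1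
  rw [twirlCoeff, ← sum_majoranaCoeff_twirl, Finset.sum_congr rfl fun T hT =>
    majoranaCoeff_twirl_eq_of_card_eq K (Finset.mem_powersetCard.1 hT).2, Finset.sum_const,
    Finset.card_powersetCard, Finset.card_univ, Fintype.card_fin, nsmul_eq_mul,
    inv_mul_cancel_left₀]
  have hS : S.card ≤ 2 * n := by simpa using S.card_le_univ
  exact_mod_cast (Nat.choose_pos hS).ne'

theorem majoranaCoeff_twirl (K : Op n →ₗ[ℂ] Op n) (S : Finset (Fin (2 * n))) (A : Op n) :
    majoranaCoeff S (twirl K A) = twirlCoeff K S.card * majoranaCoeff S A := by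
  conv_lhs => rw [← majorana_expansion A]
  simp only [map_sum, map_smul, twirl_majoranaProd_eq, majoranaCoeff_majoranaProd, smul_eq_mul]
  simp [mul_comm]

/-! ### The noisy shadow channel -/

/-- The measurement channel as a linear map. -/
def measurementLinear (n : ℕ) : Op n →ₗ[ℂ] Op n :=
  ∑ x, (Matrix.traceLinearMap (Bits n) ℂ ℂ ∘ₗ LinearMap.mulLeft ℂ (proj x)).smulRight (proj x)

theorem measurementLinear_apply (A : Op n) : measurementLinear n A = measurementChannel A := by
  simp [measurementLinear, measurementChannel]

theorem trace_proj_mul (x : Bits n) (A : Op n) : (proj x * A).trace = A x x := by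
  rw [proj, Matrix.trace_single_mul, one_smul]

theorem noisyShadowChannel_eq_twirl (Λ : Op n →ₗ[ℂ] Op n) (A : Op n) :
    noisyShadowChannel Λ A = twirl (measurementLinear n ∘ₗ Λ) A := by
  ext y z
  rw [twirl_apply]
  simp only [conjSuper, LinearMap.comp_apply, measurementLinear_apply]
  rfl

theorem majoranaCoeff_measurement (S : Finset (Fin (2 * n))) (A : Op n) :
    majoranaCoeff S (measurementLinear n A) =
      (2 ^ n : ℂ)⁻¹ * ∑ x, star (majoranaProd S x x) * A x x := by
  rw [measurementLinear_apply, majoranaCoeff_apply, measurementChannel, Finset.mul_sum,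
    Matrix.trace_sum]
  congr 1
  refine Finset.sum_congr rfl fun x _ => ?_
  rw [mul_smul_comm, Matrix.trace_smul, Matrix.trace_mul_comm (majoranaProd S)ᴴ, trace_proj_mul, trace_proj_mul,
    Matrix.conjTranspose_apply, smul_eq_mul, mul_comm]

/-- The factor `(-i)^|S|` is the conjugate of the phase `i^|S|` on the diagonal of `γ_{D(S)}`. -/
theorem majoranaCoeff_measurement_pairs (S : Finset (Fin n)) (A : Op n) :
    majoranaCoeff (pairs S) (measurementLinear n A) =
      (2 ^ n : ℂ)⁻¹ * ((-Complex.I) ^ S.card *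
        ∑ x : Bits n, (-1 : ℂ) ^ (∑ j ∈ S, (x j : ℕ)) * (proj x * A).trace) := by
  rw [majoranaCoeff_measurement, Finset.mul_sum (a := (-Complex.I) ^ S.card)]
  congr 1
  refine Finset.sum_congr rfl fun x _ => ?_
  rw [majoranaProd_pairs, Matrix.diagonal_apply_eq, trace_proj_mul]
  simp [mul_assoc]

theorem majoranaCoeff_measurement_eq_zero {S : Finset (Fin (2 * n))} (hS : S ∉ Set.range pairs)
    (A : Op n) : majoranaCoeff S (measurementLinear n A) = 0 := by
  rw [majoranaCoeff_measurement]
  simp [majoranaProd_diag_eq_zero hS]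

theorem twirlCoeff_measurement_of_odd (Λ : Op n →ₗ[ℂ] Op n) {k : ℕ} (hk : Odd k) :
    twirlCoeff (measurementLinear n ∘ₗ Λ) k = 0 := by
  rw [twirlCoeff, Finset.sum_eq_zero, mul_zero]
  intro S hS
  refine majoranaCoeff_measurement_eq_zero ?_ _
  rintro ⟨T, rfl⟩
  rw [Finset.mem_powersetCard, card_pairs] at hS
  rw [← hS.2] at hk
  exact (Nat.not_odd_iff_even.2 (even_two_mul _)) hk

theorem twirlCoeff_measurement (Λ : Op n →ₗ[ℂ] Op n) {k : ℕ} (hk : k ≤ n) :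
    twirlCoeff (measurementLinear n ∘ₗ Λ) (2 * k) =
      ((2 * n).choose (2 * k) : ℂ)⁻¹ * (n.choose k : ℂ) * avgFidelity Λ k := by
  -- `avgFidelity` divides by `C(n,k)`; this is where `k ≤ n` is needed to cancel it.
  have hc : (n.choose k : ℂ) ≠ 0 := by exact_mod_cast (Nat.choose_pos hk).ne'
  -- Among index sets of size `2k`, only the `D(T)` with `|T| = k` contribute.
  have hsum : ∑ S ∈ (Finset.univ : Finset (Fin (2 * n))).powersetCard (2 * k),
        majoranaCoeff S (measurementLinear n (Λ (majoranaProd S))) =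
      ∑ S ∈ (Finset.univ : Finset (Fin n)).powersetCard k,
        majoranaCoeff (pairs S) (measurementLinear n (Λ (majoranaProd (pairs S)))) := by
    rw [← Finset.sum_image (f := fun S =>
      majoranaCoeff S (measurementLinear n (Λ (majoranaProd S)))) pairs_injective.injOn]
    symm
    refine Finset.sum_subset ?_ ?_
    · intro S hS
      obtain ⟨T, hT, rfl⟩ := Finset.mem_image.1 hS
      rw [Finset.mem_powersetCard, card_pairs, (Finset.mem_powersetCard.1 hT).2]
      exact ⟨Finset.subset_univ _, rfl⟩
    · intro S hS hS'
      refine majoranaCoeff_measurement_eq_zero ?_ _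
      rintro ⟨T, rfl⟩
      refine hS' (Finset.mem_image_of_mem _ (Finset.mem_powersetCard.2 ⟨Finset.subset_univ _, ?_⟩))
      rw [Finset.mem_powersetCard, card_pairs] at hS
      omega
  have hS : ∀ S ∈ (Finset.univ : Finset (Fin n)).powersetCard k,
      majoranaCoeff (pairs S) (measurementLinear n (Λ (majoranaProd (pairs S)))) =
      (2 ^ n : ℂ)⁻¹ * ((-Complex.I) ^ k * ∑ x : Bits n,
        (-1 : ℂ) ^ (∑ j ∈ S, (x j : ℕ)) * (proj x * Λ (majoranaProd (pairs S))).trace) := by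
    intro S hS
    rw [majoranaCoeff_measurement_pairs, (Finset.mem_powersetCard.1 hS).2]
  rw [twirlCoeff, mul_assoc]
  congr 1
  simp only [LinearMap.comp_apply]
  rw [hsum, Finset.sum_congr rfl hS, avgFidelity, Finset.sum_comm, ← Finset.mul_sum,
    ← Finset.mul_sum]
  field_simp

theorem noisyShadowChannel_eq_sum (Λ : Op n →ₗ[ℂ] Op n) (A : Op n) :
    noisyShadowChannel Λ A = ∑ k : Fin (n + 1),
      (((2 * n).choose (2 * k) : ℂ)⁻¹ * (n.choose k : ℂ) * avgFidelity Λ k) •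
        majoranaProjector n (2 * k) A := by
  rw [noisyShadowChannel_eq_twirl]
  refine op_ext fun S => ?_
  simp only [majoranaCoeff_twirl, ← projectorLinear_apply, map_sum, map_smul,
    majoranaCoeff_projectorLinear, smul_eq_mul, mul_ite, mul_zero]
  have hS : S.card ≤ 2 * n := by simpa using S.card_le_univ
  rcases Nat.even_or_odd' S.card with ⟨k, hk | hk⟩
  · have hkn : k ≤ n := by omega
    rw [hk, Finset.sum_eq_single ⟨k, by omega⟩, if_pos rfl, twirlCoeff_measurement Λ hkn]
    · intro l _ hl
      refine if_neg fun h => hl (Fin.ext ?_)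
      simp only
      omega
    · simp
  · rw [twirlCoeff_measurement_of_odd Λ ⟨k, hk⟩, zero_mul, Finset.sum_eq_zero]
    intro l _
    exact if_neg (by omega)

/-- The projectors onto the `Γ_{2k}` are linearly independent. -/
theorem coeff_eq_of_sum_projector_eq {f g : Fin (n + 1) → ℂ}
    (h : ∀ A, ∑ k : Fin (n + 1), f k • majoranaProjector n (2 * k) A =
      ∑ k : Fin (n + 1), g k • majoranaProjector n (2 * k) A) : f = g := by
  ext k
  -- A set of `k ≤ n` modes provides a nonzero test vector `γ_{D(S)}` in `Γ_{2k}`, which isolates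
  -- the `k`-th coefficient.
  obtain ⟨S, -, hS⟩ := Finset.exists_subset_card_eq
    (s := (Finset.univ : Finset (Fin n))) (n := k) (by simpa using Nat.lt_succ_iff.1 k.2)
  have hk : ∀ f : Fin (n + 1) → ℂ, majoranaCoeff (pairs S)
      (∑ l : Fin (n + 1), f l • majoranaProjector n (2 * l) (majoranaProd (pairs S))) = f k := by
    intro f
    simp only [← projectorLinear_apply, map_sum, map_smul, majoranaCoeff_projectorLinear,
      majoranaCoeff_self, card_pairs, hS, smul_eq_mul, mul_ite, mul_one, mul_zero]
    rw [Finset.sum_eq_single k]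
    · simp
    · intro l _ hl
      refine if_neg fun h => hl (Fin.ext ?_)
      omega
    · simp
  rw [← hk f, h, hk g]

/-- The sign `(-1)^{x_S}` meets itself on the diagonal of `γ_{D(S)}` and squares to one. Each of the
`2^n C(n,k)` terms is then `i^k`, cancelled by the prefactor. -/
theorem avgFidelity_id {k : ℕ} (hk : k ≤ n) :
    avgFidelity (n := n) LinearMap.id k = 1 := by
  have hc : (n.choose k : ℂ) ≠ 0 := by exact_mod_cast (Nat.choose_pos hk).ne'
  have h : ∀ x : Bits n, ∀ S ∈ (Finset.univ : Finset (Fin n)).powersetCard k,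
      (-1 : ℂ) ^ (∑ j ∈ S, (x j : ℕ)) *
        (proj x * (LinearMap.id : Op n →ₗ[ℂ] Op n) (majoranaProd (pairs S))).trace =
      Complex.I ^ k := by
    intro x S hS
    rw [LinearMap.id_apply, trace_proj_mul, majoranaProd_pairs, Matrix.diagonal_apply_eq,
      (Finset.mem_powersetCard.1 hS).2, mul_left_comm, ← pow_add, ← two_mul, pow_mul]
    simp
  rw [avgFidelity, Finset.sum_congr rfl fun x _ => Finset.sum_congr rfl (h x)]
  have hI : (-Complex.I) ^ k * Complex.I ^ k = 1 := by
    rw [← mul_pow, neg_mul, Complex.I_mul_I, neg_neg, one_pow]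
  simp only [Finset.sum_const, Finset.card_univ, Finset.card_powersetCard, Fintype.card_pi,
    Fintype.card_fin, Finset.prod_const, nsmul_eq_mul]
  push_cast
  field_simp
  exact hI

theorem noisyShadowChannel_id (A : Op n) :
    noisyShadowChannel LinearMap.id A = shadowChannel A := by
  ext y z
  refine integral_congr_ae (Filter.Eventually.of_forall fun Q => ?_)
  refine congrFun (congrFun ?_ y) z
  simp only [unitaryChannel, measurementChannel, LinearMap.id_apply, trace_proj_mul,
    Matrix.conjTranspose_conjTranspose, Finset.mul_sum, Finset.sum_mul, mul_smul_comm,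
    smul_mul_assoc]
  rfl

end FermionicShadow

end

theorem mainTheorem3 (n : ℕ) :
    (∀ Λ : FermionicShadow.Op n →ₗ[ℂ] FermionicShadow.Op n,
      (∃! f : Fin (n + 1) → ℂ, ∀ A, FermionicShadow.noisyShadowChannel Λ A =
        ∑ k : Fin (n + 1), f k • FermionicShadow.majoranaProjector n (2 * k) A) ∧
      (∀ f : Fin (n + 1) → ℂ,
        (∀ A, FermionicShadow.noisyShadowChannel Λ A =
          ∑ k : Fin (n + 1), f k • FermionicShadow.majoranaProjector n (2 * k) A) →
        ∀ k : Fin (n + 1), f k =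
          ((2 * n).choose (2 * k) : ℂ)⁻¹ * (n.choose k : ℂ) *
            FermionicShadow.avgFidelity Λ k)) ∧
    (∀ k ≤ n, FermionicShadow.avgFidelity (n := n) LinearMap.id k = 1) ∧
    (∀ A : FermionicShadow.Op n,
      FermionicShadow.noisyShadowChannel LinearMap.id A = FermionicShadow.shadowChannel A ∧
      FermionicShadow.shadowChannel A =
        ∑ k : Fin (n + 1), ((n.choose k : ℂ) / ((2 * n).choose (2 * k) : ℂ)) •
          FermionicShadow.majoranaProjector n (2 * k) A) := by
  have huniq : ∀ (Λ : FermionicShadow.Op n →ₗ[ℂ] FermionicShadow.Op n) (f : Fin (n + 1) → ℂ),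
      (∀ A, FermionicShadow.noisyShadowChannel Λ A =
        ∑ k : Fin (n + 1), f k • FermionicShadow.majoranaProjector n (2 * k) A) →
      f = fun k : Fin (n + 1) => ((2 * n).choose (2 * k) : ℂ)⁻¹ * (n.choose k : ℂ) *
        FermionicShadow.avgFidelity Λ k := fun Λ f hf =>
    FermionicShadow.coeff_eq_of_sum_projector_eq fun A => by
      rw [← hf A, FermionicShadow.noisyShadowChannel_eq_sum]
  refine ⟨fun Λ => ⟨⟨_, FermionicShadow.noisyShadowChannel_eq_sum Λ, huniq Λ⟩,
    fun f hf k => congrFun (huniq Λ f hf) k⟩, fun k hk => FermionicShadow.avgFidelity_id hk,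
    fun A => ⟨FermionicShadow.noisyShadowChannel_id A, ?_⟩⟩
  rw [← FermionicShadow.noisyShadowChannel_id, FermionicShadow.noisyShadowChannel_eq_sum]
  refine Finset.sum_congr rfl fun k _ => ?_
  rw [FermionicShadow.avgFidelity_id (Nat.lt_succ_iff.1 k.2), mul_one, div_eq_inv_mul]
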